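/- **Soundness of the isometry judgment of Qunity.** **Types, spaces.** Types: $T ::= \mathtt{Void}\mid\mathtt{Unit}\mid T\oplus T\mid T\otimes T$, and $\mathrm{Bit}=\mathtt{Unit}\oplus\mathtt{Unit}$. $\mathbb V(T)$ is the finite set of closed values of $T$ (none for $\mathtt{Void}$; $()$ for $\mathtt{Unit}$; tagged values for sums; pairs for products), and $\mathcal H(T)$ is the Hilbert space with orthonormal basis $\{|v\rangle\}_{v\in\mathbb V(T)}$. A context $\Gamma,\Delta,\dots$ is a finite unordered set of bindings $x:T$ with distinct names; a comma denotes disjoint union; $\mathbb V(\Delta)$ is the set of assignments of a value in $\mathbb V(T)$ to each $x:T$ in $\Delta$; $\mathcal H(\Delta)$ has orthonormal basis $\{|\tau\rangle\}_{\tau\in\mathbb V(\Delta)}$. **Syntax.** Expressions: $e ::= ()\mid x\mid (e,e)\mid \mathtt{ctrl}_{T,T'}\,e\,\{e_j\mapsto e_j'\}_{j=1}^n\mid\mathtt{match}_{T,T'}\,e\,\{e_j\mapsto e_j'\}_{j=1}^n\mid\mathtt{try}\,e\,\mathtt{catch}\,e\mid f\,e$. Programs: $f ::= \mathtt{u3}(r_\theta,r_\phi,r_\lambda)\mid\mathtt{left}_{T_0,T_1}\mid\mathtt{right}_{T_0,T_1}\mid\lambda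 e\overset{T}{\mapsto}e'\mid\mathtt{rphase}_T(e,r,r')\mid\mathtt{pmatch}_{T,T'}\{e_j\mapsto e_j'\}_{j=1}^n$ ($r$'s real, $n\ge0$). $\mathrm{FV}(e)$ is the set of free variables (a pattern $e_j$ binds its variables in $e_j'$; programs are closed). $\mathtt{classical}(e)$: neither $\mathtt{u3}$ nor $\mathtt{rphase}$ occurs in $e$. $\mathtt{gphase}_T(r)=\mathtt{rphase}_T(y,r,r)$ with a variable $y$. The following judgments are defined by mutual induction. **Pure typing** $\Gamma\|\Delta\vdash e:T$. $\Gamma\|\varnothing\vdash():\mathtt{Unit}$. $\Gamma\|\varnothing\vdash x:T$ if $(x:T)\in\Gamma$. $\Gamma\|x:T\vdash x:T$ if $x\notin\mathrm{dom}\,\Gamma$. If $\Gamma\|\Delta,\Delta_i\vdash e_i:T_i$ ($i=0,1$) then $\Gamma\|\Delta,\Delta_0,\Delta_1\vdash(e_0,e_1):T_0\otimes T_1$. If $\vdash f:T\rightsquigarrow T'$ and $\Gamma\|\Delta\vdash e:T$ then $\Gamma\|\Delta\vdash f\,e:T'$. If $\Gamma\|\Delta\Vdash e:T$, $\mathtt{ortho}_T(e_1,\dots,e_n)$,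 $\mathtt{erases}_{T'}(x;e_1',\dots,e_n')$ for all $x\in\mathrm{dom}\,\Delta$, and, for all $j$, $\varnothing\|\Gamma_j\vdash e_j:T$, $\mathtt{classical}(e_j)$ and $\Gamma,\Gamma_j\|\Delta,\Delta'\vdash e_j':T'$, then $\Gamma\|\Delta,\Delta'\vdash\mathtt{ctrl}_{T,T'}\,e\,\{e_j\mapsto e_j'\}:T'$. **Mixed typing** $\Gamma\|\Delta\Vdash e:T$. $\Gamma\|\Delta\Vdash e:T$ if $\Gamma\|\Delta\vdash e:T$. $\Gamma\|\Delta,\Delta_0\Vdash e:T$ if $\Gamma\|\Delta\Vdash e:T$. Pairs and $f\,e$ as above, with $\Vdash$ for $\vdash$ and $\Rrightarrow$ for $\rightsquigarrow$. If $\Gamma\|\Delta_i\Vdash e_i:T$ then $\Gamma\|\Delta_0,\Delta_1\Vdash\mathtt{try}\,e_0\,\mathtt{catch}\,e_1:T$. If $\Gamma\|\Delta,\Delta_0\Vdash e:T$, $\mathtt{ortho}_T(e_1,\dots,e_n)$ and, for all $j$, $\varnothing\|\Gamma_j\vdash e_j:T$, $\mathtt{classical}(e_j)$, $\Gamma,\Gamma_j\|\Delta,\Delta_1\Vdash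 e_j':T'$, then $\Gamma\|\Delta,\Delta_0,\Delta_1\Vdash\mathtt{match}_{T,T'}\,e\,\{e_j\mapsto e_j'\}:T'$. **Program typing.** $\mathtt{u3}(\cdot):\mathrm{Bit}\rightsquigarrow\mathrm{Bit}$; $\mathtt{left}_{T_0,T_1}:T_0\rightsquigarrow T_0\oplus T_1$; $\mathtt{right}_{T_0,T_1}:T_1\rightsquigarrow T_0\oplus T_1$. If $\varnothing\|\Delta\vdash e:T$, then $\mathtt{rphase}_T(e,r,r'):T\rightsquigarrow T$; moreover $\lambda e\overset T\mapsto e':T\rightsquigarrow T'$ if $\varnothing\|\Delta\vdash e':T'$, and $\lambda e\overset T\mapsto e':T\Rrightarrow T'$ if $\varnothing\|\Delta\Vdash e':T'$. $\mathtt{pmatch}_{T,T'}\{e_j\mapsto e_j'\}:T\rightsquigarrow T'$ if $\mathtt{ortho}_T(e_1,\dots,e_n)$, $\mathtt{ortho}_{T'}(e_1',\dots,e_n')$ and, for all $j$, $\varnothing\|\Delta_j\vdash e_j:T$ and $\varnothing\|\Delta_j\vdash e_j':T'$. $f:T\Rrightarrow T'$ if $f:T\rightsquigarrow T'$. **Erasure.**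 $\mathtt{erases}_T(x;x,\dots,x)$. It is preserved when an entry $e_j$ is replaced by $\mathtt{gphase}_T(r)\,e_j$, and when consecutive entries $e_{j,1},\dots,e_{j,m}$ are replaced by the single entry $\mathtt{ctrl}_{T',T}\,e\,\{e_k'\mapsto e_{j,k}\}_{k=1}^m$ whose patterns $e_k'$ do not bind $x$. If $\mathtt{erases}_{T_i}(x;e_{i,1},\dots,e_{i,n})$ for $i=0$ or $i=1$, then $\mathtt{erases}_{T_0\otimes T_1}(x;(e_{0,1},e_{1,1}),\dots,(e_{0,n},e_{1,n}))$. **Orthogonality and spanning.** Both $\mathtt{ortho}$ and $\mathtt{spanning}$ are closed under: the empty list for $\mathtt{Void}$; the list $()$ for $\mathtt{Unit}$; the list $x$ for any $T$; from $e_1,\dots,e_n$ for $T_0$ and $e_1',\dots,e_{n'}'$ for $T_1$, the list $\mathtt{left}\,e_1,\dots,\mathtt{left}\,e_n,\mathtt{right}\,e_1',\dots,\mathtt{right}\,e_{n'}'$ for $T_0\oplus T_1$; from $e_1,\dots,e_m$ for $T_0$ and, for each $j$, $e_{j,1}',\dots,e_{j,n_j}'$ for $T_1$ with $\mathrm{FV}(e_j)\cap\bigcup_k\mathrm{FV}(e_{j,k}')=\varnothing$,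 the list of all $(e_j,e_{j,k}')$ in lexicographic order for $T_0\otimes T_1$. In addition $\mathtt{ortho}$ is closed under subsequences and under $e_1,\dots,e_n$ for $T$ $\Rightarrow$ $f\,e_1,\dots,f\,e_n$ for $T'$ when $\vdash f:T\rightsquigarrow T'$ and $\mathtt{iso}(f)$; $\mathtt{spanning}$ is closed under the latter step when moreover $\dim\mathcal H(T)=\dim\mathcal H(T')$. **Isometry judgment.** $\mathtt{iso}$ holds for $()$, $x$, $\mathtt{u3}(\cdot)$, $\mathtt{left}$, $\mathtt{right}$; for $(e_0,e_1)$ if $\mathtt{iso}(e_0)$ and $\mathtt{iso}(e_1)$; for $f\,e$ if $\mathtt{iso}(f)$ and $\mathtt{iso}(e)$; for $\mathtt{try}\,e_0\,\mathtt{catch}\,e_1$ if $\mathtt{iso}(e_0)$ or $\mathtt{iso}(e_1)$; for $\mathtt{ctrl}_{T,T'}\,e\,\{e_j\mapsto e_j'\}$ and $\mathtt{match}_{T,T'}\,e\,\{e_j\mapsto e_j'\}$ if $\mathtt{classical}(e)$, $\mathtt{iso}(e)$, $\mathtt{spanning}_T(e_1,\dots,e_n)$ and $\mathtt{iso}(e_j')$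 for all $j$; for $\lambda e\overset T\mapsto e'$ if $\mathtt{spanning}_T(e)$ and $\mathtt{iso}(e')$; for $\mathtt{rphase}_T(e,r,r')$ if $\mathtt{iso}(e)$; for $\mathtt{pmatch}_{T,T'}\{e_j\mapsto e_j'\}$ if $\mathtt{spanning}_T(e_1,\dots,e_n)$ and $\mathtt{iso}(e_j')$ for all $j$. **Semantics** (by recursion on typing derivations; operators are given on basis vectors $|\tau\rangle$, superoperators on $|\tau\rangle\langle\tau'|$, and extended linearly). *Pure expressions*, $\llbracket e\rrbracket_\sigma:\mathcal H(\Delta)\to\mathcal H(T)$ for $\sigma\in\mathbb V(\Gamma)$: $()\mapsto|()\rangle$; a classical variable gives $|\sigma(x)\rangle$; a quantum variable sends $|x\mapsto v\rangle$ to $|v\rangle$; $\llbracket(e_0,e_1)\rrbracket_\sigma|\tau,\tau_0,\tau_1\rangle=\llbracket e_0\rrbracket_\sigma|\tau,\tau_0\rangle\otimes\llbracket e_1\rrbracket_\sigma|\tau,\tau_1\rangle$; $\llbracket f\,e\rrbracket_\sigma=\llbracket f\rrbracket\llbracket e\rrbracket_\sigma$; and $\mathtt{ctrl}$ sends $|\tau,\tau'\rangle$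 to $$\sum_{v\in\mathbb V(T)}\langle v|\llbracket e\rrbracket_\sigma(|\tau\rangle\langle\tau|)|v\rangle\sum_{j=1}^n\sum_{\sigma_j\in\mathbb V(\Gamma_j)}\langle\sigma_j|\llbracket e_j\rrbracket^\dagger|v\rangle\,\llbracket e_j'\rrbracket_{\sigma,\sigma_j}|\tau,\tau'\rangle .$$ *Mixed expressions*, $\llbracket e\rrbracket_\sigma:\mathcal L(\mathcal H(\Delta))\to\mathcal L(\mathcal H(T))$: a purely typed $e$ gives $\rho\mapsto\llbracket e\rrbracket_\sigma\,\rho\,\llbracket e\rrbracket_\sigma^\dagger$; discarding: $\rho\otimes\rho_0\mapsto\mathrm{tr}(\rho_0)\llbracket e\rrbracket_\sigma(\rho)$; pairs: $|\tau,\tau_0,\tau_1\rangle\langle\tau',\tau_0',\tau_1'|\mapsto\llbracket e_0\rrbracket_\sigma(|\tau,\tau_0\rangle\langle\tau',\tau_0'|)\otimes\llbracket e_1\rrbracket_\sigma(|\tau,\tau_1\rangle\langle\tau',\tau_1'|)$; $\mathtt{try}\,e_0\,\mathtt{catch}\,e_1$: $\rho_0\otimes\rho_1\mapsto\mathrm{tr}(\rho_1)\llbracket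 e_0\rrbracket_\sigma(\rho_0)+(\mathrm{tr}(\rho_0)-\mathrm{tr}(\llbracket e_0\rrbracket_\sigma(\rho_0)))\llbracket e_1\rrbracket_\sigma(\rho_1)$; $\llbracket f\,e\rrbracket_\sigma=\llbracket f\rrbracket\circ\llbracket e\rrbracket_\sigma$; and $\mathtt{match}$ sends $|\tau,\tau_0,\tau_1\rangle\langle\tau',\tau_0',\tau_1'|$ to $$\sum_{v\in\mathbb V(T)}\langle v|\llbracket e\rrbracket_\sigma(|\tau,\tau_0\rangle\langle\tau',\tau_0'|)|v\rangle\sum_{j=1}^n\sum_{\sigma_j\in\mathbb V(\Gamma_j)}\langle\sigma_j|\llbracket e_j\rrbracket^\dagger|v\rangle\,\llbracket e_j'\rrbracket_{\sigma,\sigma_j}(|\tau,\tau_1\rangle\langle\tau',\tau_1'|).$$ *Coherent maps*: $\mathtt{left},\mathtt{right}$ are the injections; $\llbracket\mathtt{u3}(r_\theta,r_\phi,r_\lambda)\rrbracket$ sends $|0\rangle$ to $\cos\frac{r_\theta}2|0\rangle+e^{ir_\phi}\sin\frac{r_\theta}2|1\rangle$ and $|1\rangle$ to $-e^{ir_\lambda}\sin\frac{r_\theta}2|0\rangle+e^{i(r_\phi+r_\lambda)}\cos\frac{r_\theta}2|1\rangle$,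 where $0,1$ are the left and right values of $\mathrm{Bit}$; $\llbracket\lambda e\mapsto e'\rrbracket=\llbracket e'\rrbracket\llbracket e\rrbracket^\dagger$; $\llbracket\mathtt{rphase}_T(e,r,r')\rrbracket=e^{ir}\llbracket e\rrbracket\llbracket e\rrbracket^\dagger+e^{ir'}(\mathbb I-\llbracket e\rrbracket\llbracket e\rrbracket^\dagger)$; $\llbracket\mathtt{pmatch}\{e_j\mapsto e_j'\}\rrbracket=\sum_j\llbracket e_j'\rrbracket\llbracket e_j\rrbracket^\dagger$. *Channels*: a coherent map $f$ gives $\rho\mapsto\llbracket f\rrbracket\rho\llbracket f\rrbracket^\dagger$, and $\llbracket\lambda e\mapsto e'\rrbracket(\rho)=\llbracket e'\rrbracket(\llbracket e\rrbracket^\dagger\rho\llbracket e\rrbracket)$. **Lemma.** For every typing derivation: 1. If $\Gamma\|\Delta\vdash e:T$ and $\mathtt{iso}(e)$, then $\big\|\llbracket\sigma:\Gamma\|\Delta\vdash e:T\rrbracket|\psi\rangle\big\|=\||\psi\rangle\|$ for all $\sigma\in\mathbb V(\Gamma)$, $|\psi\rangle\in\mathcal H(\Delta)$. 2. If $\Gamma\|\Delta\Vdash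 e:T$ and $\mathtt{iso}(e)$, then $\mathrm{tr}\big(\llbracket\sigma:\Gamma\|\Delta\Vdash e:T\rrbracket(\rho)\big)=\mathrm{tr}(\rho)$ for all $\sigma\in\mathbb V(\Gamma)$, $\rho\in\mathcal L(\mathcal H(\Delta))$. 3. If $\vdash f:T\rightsquigarrow T'$ and $\mathtt{iso}(f)$, then $\big\|\llbracket\vdash f:T\rightsquigarrow T'\rrbracket|\psi\rangle\big\|=\||\psi\rangle\|$ for all $|\psi\rangle\in\mathcal H(T)$. 4. If $\vdash f:T\Rrightarrow T'$ and $\mathtt{iso}(f)$, then $\mathrm{tr}\big(\llbracket\vdash f:T\Rrightarrow T'\rrbracket(\rho)\big)=\mathrm{tr}(\rho)$ for all $\rho\in\mathcal L(\mathcal H(T))$. -/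

import Mathlib

noncomputable section

namespace Qunity

/-! ## Types, basis values and Hilbert spaces -/

/-- Data types. -/
inductive Ty : Type
  | void : Ty
  | unit : Ty
  | sum : Ty → Ty → Ty
  | prod : Ty → Ty → Ty
  deriving DecidableEq

/-- The classical values `𝕍(T)` of type `T`: none for `Void`, one for `Unit`, tagged values for a
sum, pairs for a product. -/
inductive Ty.Val : Ty → Type
  | unit : Ty.Val .unit
  | left {T₀ T₁ : Ty} : Ty.Val T₀ → Ty.Val (.sum T₀ T₁)
  | right {T₀ T₁ : Ty} : Ty.Val T₁ → Ty.Val (.sum T₀ T₁)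
  | pair {T₀ T₁ : Ty} : Ty.Val T₀ → Ty.Val T₁ → Ty.Val (.prod T₀ T₁)

def Ty.Val.voidEquiv : Ty.Val .void ≃ Empty where
  toFun v := nomatch v
  invFun v := nomatch v
  left_inv v := nomatch v
  right_inv v := nomatch v

def Ty.Val.unitEquiv : Ty.Val .unit ≃ Unit where
  toFun _ := ()
  invFun _ := .unit
  left_inv v := by cases v; rfl
  right_inv _ := rfl

def Ty.Val.sumEquiv (T₀ T₁ : Ty) : Ty.Val (.sum T₀ T₁) ≃ Ty.Val T₀ ⊕ Ty.Val T₁ where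
  toFun
    | .left v => .inl v
    | .right v => .inr v
  invFun
    | .inl v => .left v
    | .inr v => .right v
  left_inv v := by cases v <;> rfl
  right_inv v := by cases v <;> rfl

def Ty.Val.prodEquiv (T₀ T₁ : Ty) : Ty.Val (.prod T₀ T₁) ≃ Ty.Val T₀ × Ty.Val T₁ where
  toFun
    | .pair v w => (v, w)
  invFun p := .pair p.1 p.2
  left_inv v := by cases v; rfl
  right_inv _ := rfl

instance Ty.decEqVal : (T : Ty) → DecidableEq T.Val
  | .void => Ty.Val.voidEquiv.decidableEq
  | .unit => Ty.Val.unitEquiv.decidableEq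
  | .sum T₀ T₁ =>
    letI := Ty.decEqVal T₀
    letI := Ty.decEqVal T₁
    (Ty.Val.sumEquiv T₀ T₁).decidableEq
  | .prod T₀ T₁ =>
    letI := Ty.decEqVal T₀
    letI := Ty.decEqVal T₁
    (Ty.Val.prodEquiv T₀ T₁).decidableEq

instance Ty.fintypeVal : (T : Ty) → Fintype T.Val
  | .void => Fintype.ofEquiv _ Ty.Val.voidEquiv.symm
  | .unit => Fintype.ofEquiv _ Ty.Val.unitEquiv.symm
  | .sum T₀ T₁ =>
    letI := Ty.fintypeVal T₀
    letI := Ty.fintypeVal T₁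
    Fintype.ofEquiv _ (Ty.Val.sumEquiv T₀ T₁).symm
  | .prod T₀ T₁ =>
    letI := Ty.fintypeVal T₀
    letI := Ty.fintypeVal T₁
    Fintype.ofEquiv _ (Ty.Val.prodEquiv T₀ T₁).symm

/-- `Bit = Unit ⊕ Unit`; the value `0` is the left one, `1` the right one. -/
abbrev Ty.bit : Ty := .sum .unit .unit

/-- The Hilbert space `ℋ(T)`, with its orthonormal basis `|v⟩`, `v ∈ 𝕍(T)`. -/
abbrev Ty.H (T : Ty) : Type := EuclideanSpace ℂ T.Val

/-- Variable names. -/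
abbrev Name : Type := ℕ

/-- Contexts: finite sets of bindings `x : T` in which every name is bound at most once. -/
structure Ctx : Type where
  binds : Finset (Name × Ty)
  unique : ∀ p ∈ binds, ∀ q ∈ binds, p.1 = q.1 → p = q

/-- The empty context. -/
def Ctx.empty : Ctx := ⟨∅, by simp⟩

/-- The context `x : T`. -/
def Ctx.single (x : Name) (T : Ty) : Ctx := ⟨{(x, T)}, by simp⟩

theorem Ctx.mem_single (x : Name) (T : Ty) : (x, T) ∈ (Ctx.single x T).binds :=
  Finset.mem_singleton_self (x, T)

/-- The names bound in a context. -/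
def Ctx.dom (Δ : Ctx) : Finset Name := Δ.binds.image Prod.fst

/-- `Δ = Δ₀, Δ₁`: the context `Δ` is the disjoint union of `Δ₀` and `Δ₁`. -/
structure IsSplit (Δ Δ₀ Δ₁ : Ctx) : Prop where
  eq : Δ.binds = Δ₀.binds ∪ Δ₁.binds
  disj : Disjoint Δ₀.binds Δ₁.binds

/-- `Δ` is the union of the possibly overlapping contexts `Δ₀` and `Δ₁`. Equivalently, for pairwise
disjoint `Ξ, Ξ₀, Ξ₁` one has `Δ = Ξ, Ξ₀, Ξ₁` and `Δ₀ = Ξ, Ξ₀` and `Δ₁ = Ξ, Ξ₁`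
(`Ξ` is the common part of `Δ₀` and `Δ₁`). -/
structure IsJoin (Δ Δ₀ Δ₁ : Ctx) : Prop where
  eq : Δ.binds = Δ₀.binds ∪ Δ₁.binds

theorem IsJoin.left {Δ Δ₀ Δ₁ : Ctx} (h : IsJoin Δ Δ₀ Δ₁) : Δ₀.binds ⊆ Δ.binds := by
  rw [h.eq]; exact Finset.subset_union_left

theorem IsJoin.right {Δ Δ₀ Δ₁ : Ctx} (h : IsJoin Δ Δ₀ Δ₁) : Δ₁.binds ⊆ Δ.binds := by
  rw [h.eq]; exact Finset.subset_union_right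

theorem IsSplit.left {Δ Δ₀ Δ₁ : Ctx} (h : IsSplit Δ Δ₀ Δ₁) : Δ₀.binds ⊆ Δ.binds := by
  rw [h.eq]; exact Finset.subset_union_left

theorem IsSplit.right {Δ Δ₀ Δ₁ : Ctx} (h : IsSplit Δ Δ₀ Δ₁) : Δ₁.binds ⊆ Δ.binds := by
  rw [h.eq]; exact Finset.subset_union_right

/-- Valuations `𝕍(Δ)`: a value of the right type for every binding of `Δ`. -/
def Ctx.Valn (Δ : Ctx) : Type := (p : Δ.binds) → p.1.2.Val

instance Ctx.fintypeValn (Δ : Ctx) : Fintype Δ.Valn :=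
  inferInstanceAs (Fintype ((p : Δ.binds) → p.1.2.Val))

instance Ctx.decEqValn (Δ : Ctx) : DecidableEq Δ.Valn :=
  inferInstanceAs (DecidableEq ((p : Δ.binds) → p.1.2.Val))

/-- The Hilbert space `ℋ(Δ)`, with its orthonormal basis `|τ⟩`, `τ ∈ 𝕍(Δ)`. -/
abbrev Ctx.H (Δ : Ctx) : Type := EuclideanSpace ℂ Δ.Valn

/-- The empty valuation. -/
def Valn.empty : Ctx.empty.Valn := fun p => absurd p.2 (Finset.notMem_empty p.1)

/-- Restriction of a valuation to a smaller context. -/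
def Valn.res {Δ Δ₀ : Ctx} (h : Δ₀.binds ⊆ Δ.binds) (τ : Δ.Valn) : Δ₀.Valn :=
  fun p => τ ⟨p.1, h p.2⟩

/-- The valuation `σ₀, σ₁` of the context `Γ = Γ₀, Γ₁`. -/
def Valn.append {Γ Γ₀ Γ₁ : Ctx} (h : IsSplit Γ Γ₀ Γ₁) (σ₀ : Γ₀.Valn) (σ₁ : Γ₁.Valn) : Γ.Valn :=
  fun p =>
    if h₀ : p.1 ∈ Γ₀.binds then σ₀ ⟨p.1, h₀⟩
    else σ₁ ⟨p.1, (Finset.mem_union.mp (h.eq ▸ p.2)).resolve_left h₀⟩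

/-! ## Syntax -/

mutual
/-- Expressions. In `ctrl e T n lhs rhs T'` and `mtch e T n lhs rhs T'` the scrutinee `e` has type
`T`, the `n` branches are `lhs j ↦ rhs j`, and the result has type `T'`. -/
inductive Exp : Type
  | unit : Exp
  | var : Name → Exp
  | pair : Exp → Exp → Exp
  | ctrl : Exp → Ty → (n : ℕ) → (Fin n → Exp) → (Fin n → Exp) → Ty → Exp
  | mtch : Exp → Ty → (n : ℕ) → (Fin n → Exp) → (Fin n → Exp) → Ty → Exp
  | trycatch : Exp → Exp → Exp
  | app : Prog → Exp → Exp
/-- Programs: `lam e T e'` is `λ e ↦ e'` with argument type `T`; `pmatch T n lhs rhs T'` has the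
`n` branches `lhs j ↦ rhs j`. -/
inductive Prog : Type
  | u3 : ℝ → ℝ → ℝ → Prog
  | left : Ty → Ty → Prog
  | right : Ty → Ty → Prog
  | lam : Exp → Ty → Exp → Prog
  | rphase : Ty → Exp → ℝ → ℝ → Prog
  | pmatch : Ty → (n : ℕ) → (Fin n → Exp) → (Fin n → Exp) → Ty → Prog
end

/-- The global phase `gphase_T(r)` is sugar for `rphase_T(y, r, r)` with a variable pattern `y`. -/
def gphase (T : Ty) (y : Name) (r : ℝ) : Prog := .rphase T (.var y) r r

/-- Free variables; variables in patterns bind the right-hand sides, and programs are closed. -/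
def Exp.fv : Exp → Finset Name
  | .unit => ∅
  | .var x => {x}
  | .pair e₀ e₁ => e₀.fv ∪ e₁.fv
  | .ctrl e _ _ lhs rhs _ => e.fv ∪ Finset.univ.biUnion fun j => (rhs j).fv \ (lhs j).fv
  | .mtch e _ _ lhs rhs _ => e.fv ∪ Finset.univ.biUnion fun j => (rhs j).fv \ (lhs j).fv
  | .trycatch e₀ e₁ => e₀.fv ∪ e₁.fv
  | .app _ e => e.fv

mutual
/-- `classical(e)`: no use of `u3` or `rphase` occurs anywhere in `e`. -/
def Exp.Classical : Exp → Prop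
  | .unit => True
  | .var _ => True
  | .pair e₀ e₁ => e₀.Classical ∧ e₁.Classical
  | .ctrl e _ _ lhs rhs _ =>
    e.Classical ∧ (∀ j, (lhs j).Classical) ∧ ∀ j, (rhs j).Classical
  | .mtch e _ _ lhs rhs _ =>
    e.Classical ∧ (∀ j, (lhs j).Classical) ∧ ∀ j, (rhs j).Classical
  | .trycatch e₀ e₁ => e₀.Classical ∧ e₁.Classical
  | .app f e => f.Classical ∧ e.Classical
/-- No use of `u3` or `rphase` occurs anywhere in `f`. -/
def Prog.Classical : Prog → Prop
  | .u3 _ _ _ => False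
  | .left _ _ => True
  | .right _ _ => True
  | .lam e _ e' => e.Classical ∧ e'.Classical
  | .rphase _ _ _ _ => False
  | .pmatch _ _ lhs rhs _ => (∀ j, (lhs j).Classical) ∧ ∀ j, (rhs j).Classical
end

/-! ## Judgments -/

/-- The erasure judgment `erases_T(x; e₁, …, eₙ)`. In `ctrl`, the patterns of the inlined
expression do not rebind `x` (bound names are distinct from the free name `x`). -/
inductive Erases : Ty → Name → List Exp → Prop
  | gphase {T : Ty} {x : Name} {l l' : List Exp} {e : Exp} (y : Name) (r : ℝ) :
      Erases T x (l ++ e :: l') → Erases T x (l ++ Exp.app (gphase T y r) e :: l')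
  | ctrl {T : Ty} {x : Name} {l l' : List Exp} (e : Exp) (T' : Ty) (m : ℕ)
      (lhs rhs : Fin m → Exp) (hx : ∀ k, x ∉ (lhs k).fv) :
      Erases T x (l ++ (List.ofFn rhs ++ l')) →
      Erases T x (l ++ Exp.ctrl e T' m lhs rhs T :: l')
  | var (T : Ty) (x : Name) (n : ℕ) : Erases T x (List.replicate n (Exp.var x))
  | pair₀ {T₀ : Ty} (T₁ : Ty) {x : Name} (ps : List (Exp × Exp)) :
      Erases T₀ x (ps.map Prod.fst) →
      Erases (T₀.prod T₁) x (ps.map fun p => Exp.pair p.1 p.2)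
  | pair₁ (T₀ : Ty) {T₁ : Ty} {x : Name} (ps : List (Exp × Exp)) :
      Erases T₁ x (ps.map Prod.snd) →
      Erases (T₀.prod T₁) x (ps.map fun p => Exp.pair p.1 p.2)

mutual

/-- Derivations of the pure typing judgment `Γ ∥ Δ ⊢ e : T`. -/
inductive PureTy : Ctx → Ctx → Exp → Ty → Type
  | unit (Γ : Ctx) : PureTy Γ Ctx.empty .unit .unit
  | cvar (Γ : Ctx) (x : Name) (T : Ty) (hx : (x, T) ∈ Γ.binds) :
      PureTy Γ Ctx.empty (.var x) T
  | qvar (Γ : Ctx) (x : Name) (T : Ty) (hx : x ∉ Γ.dom) :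
      PureTy Γ (Ctx.single x T) (.var x) T
  | pair {Γ Δ Δ₀ Δ₁ : Ctx} {e₀ e₁ : Exp} {T₀ T₁ : Ty} (hΔ : IsJoin Δ Δ₀ Δ₁)
      (h₀ : PureTy Γ Δ₀ e₀ T₀) (h₁ : PureTy Γ Δ₁ e₁ T₁) :
      PureTy Γ Δ (.pair e₀ e₁) (T₀.prod T₁)
  | ctrl {Γ Δ Δ₀ Δ₁ : Ctx} {e : Exp} {T T' : Ty} {n : ℕ} {lhs rhs : Fin n → Exp}
      (Γl Γr : Fin n → Ctx) (hΔ : IsSplit Δ Δ₀ Δ₁)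
      (he : MixTy Γ Δ₀ e T)
      (ho : Ortho T (List.ofFn lhs))
      (hl : ∀ j, PureTy Ctx.empty (Γl j) (lhs j) T)
      (hc : ∀ j, (lhs j).Classical)
      (her : ∀ x ∈ Δ₀.dom, Erases T' x (List.ofFn rhs))
      (hΓ : ∀ j, IsSplit (Γr j) Γ (Γl j))
      (hr : ∀ j, PureTy (Γr j) Δ (rhs j) T') :
      PureTy Γ Δ (.ctrl e T n lhs rhs T') T'
  | app {Γ Δ : Ctx} {f : Prog} {e : Exp} {T T' : Ty}
      (hf : PureProgTy f T T') (he : PureTy Γ Δ e T) : PureTy Γ Δ (.app f e) T'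

/-- Derivations of the mixed typing judgment `Γ ∥ Δ ⊩ e : T`. -/
inductive MixTy : Ctx → Ctx → Exp → Ty → Type
  | mix {Γ Δ : Ctx} {e : Exp} {T : Ty} (h : PureTy Γ Δ e T) : MixTy Γ Δ e T
  | discard {Γ Δ Δ₀ Δ₁ : Ctx} {e : Exp} {T : Ty} (hΔ : IsSplit Δ Δ₀ Δ₁)
      (h : MixTy Γ Δ₀ e T) : MixTy Γ Δ e T
  | pair {Γ Δ Δ₀ Δ₁ : Ctx} {e₀ e₁ : Exp} {T₀ T₁ : Ty} (hΔ : IsJoin Δ Δ₀ Δ₁)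
      (h₀ : MixTy Γ Δ₀ e₀ T₀) (h₁ : MixTy Γ Δ₁ e₁ T₁) :
      MixTy Γ Δ (.pair e₀ e₁) (T₀.prod T₁)
  | trycatch {Γ Δ Δ₀ Δ₁ : Ctx} {e₀ e₁ : Exp} {T : Ty} (hΔ : IsSplit Δ Δ₀ Δ₁)
      (h₀ : MixTy Γ Δ₀ e₀ T) (h₁ : MixTy Γ Δ₁ e₁ T) : MixTy Γ Δ (.trycatch e₀ e₁) T
  | app {Γ Δ : Ctx} {f : Prog} {e : Exp} {T T' : Ty}
      (hf : MixProgTy f T T') (he : MixTy Γ Δ e T) : MixTy Γ Δ (.app f e) T'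
  | mtch {Γ Δ Δ₀ Δ₁ : Ctx} {e : Exp} {T T' : Ty} {n : ℕ} {lhs rhs : Fin n → Exp}
      (Γl Γr : Fin n → Ctx) (hΔ : IsJoin Δ Δ₀ Δ₁)
      (he : MixTy Γ Δ₀ e T)
      (ho : Ortho T (List.ofFn lhs))
      (hl : ∀ j, PureTy Ctx.empty (Γl j) (lhs j) T)
      (hc : ∀ j, (lhs j).Classical)
      (hΓ : ∀ j, IsSplit (Γr j) Γ (Γl j))
      (hr : ∀ j, MixTy (Γr j) Δ₁ (rhs j) T') :
      MixTy Γ Δ (.mtch e T n lhs rhs T') T'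

/-- Derivations of `⊢ f : T ⇝ T'` (coherent maps). -/
inductive PureProgTy : Prog → Ty → Ty → Type
  | u3 (rθ rφ rl : ℝ) : PureProgTy (.u3 rθ rφ rl) Ty.bit Ty.bit
  | left (T₀ T₁ : Ty) : PureProgTy (.left T₀ T₁) T₀ (T₀.sum T₁)
  | right (T₀ T₁ : Ty) : PureProgTy (.right T₀ T₁) T₁ (T₀.sum T₁)
  | lam {Δ : Ctx} {e e' : Exp} {T T' : Ty}
      (h : PureTy Ctx.empty Δ e T) (h' : PureTy Ctx.empty Δ e' T') :
      PureProgTy (.lam e T e') T T'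
  | rphase {Δ : Ctx} {e : Exp} {T : Ty} (r r' : ℝ) (h : PureTy Ctx.empty Δ e T) :
      PureProgTy (.rphase T e r r') T T
  | pmatch {T T' : Ty} {n : ℕ} {lhs rhs : Fin n → Exp} (Δ : Fin n → Ctx)
      (ho : Ortho T (List.ofFn lhs)) (hl : ∀ j, PureTy Ctx.empty (Δ j) (lhs j) T)
      (ho' : Ortho T' (List.ofFn rhs)) (hr : ∀ j, PureTy Ctx.empty (Δ j) (rhs j) T') :
      PureProgTy (.pmatch T n lhs rhs T') T T'

/-- Derivations of `⊢ f : T ⇛ T'` (quantum channels). -/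
inductive MixProgTy : Prog → Ty → Ty → Type
  | channel {f : Prog} {T T' : Ty} (h : PureProgTy f T T') : MixProgTy f T T'
  | lam {Δ : Ctx} {e e' : Exp} {T T' : Ty}
      (h : PureTy Ctx.empty Δ e T) (h' : MixTy Ctx.empty Δ e' T') :
      MixProgTy (.lam e T e') T T'

/-- Derivations of the orthogonality judgment `ortho_T(e₁, …, eₙ)`. -/
inductive Ortho : Ty → List Exp → Type
  | void : Ortho .void []
  | unit : Ortho .unit [.unit]
  | var (T : Ty) (x : Name) : Ortho T [.var x]
  | isoApp {T T' : Ty} {f : Prog} {es : List Exp} (h : Ortho T es)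
      (hf : PureProgTy f T T') (hi : IsoProg f) : Ortho T' (es.map (Exp.app f))
  | sum {T₀ T₁ : Ty} {es es' : List Exp} (h₀ : Ortho T₀ es) (h₁ : Ortho T₁ es') :
      Ortho (T₀.sum T₁)
        (es.map (Exp.app (.left T₀ T₁)) ++ es'.map (Exp.app (.right T₀ T₁)))
  | pair {T₀ T₁ : Ty} (L : List (Exp × List Exp)) (h₀ : Ortho T₀ (L.map Prod.fst))
      (h₁ : ∀ p ∈ L, Ortho T₁ p.2)
      (hfv : ∀ p ∈ L, ∀ e' ∈ p.2, Disjoint p.1.fv e'.fv) :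
      Ortho (T₀.prod T₁) (L.flatMap fun p => p.2.map (Exp.pair p.1))
  | sub {T : Ty} {es es' : List Exp} (h : Ortho T es') (hs : es.Sublist es') : Ortho T es

/-- Derivations of the spanning judgment `spanning_T(e₁, …, eₙ)`. The last three premises of
`unApp` say that `f` is unitary: `un(⊢ f : T ⇝ T')`. -/
inductive Spanning : Ty → List Exp → Type
  | void : Spanning .void []
  | unit : Spanning .unit [.unit]
  | var (T : Ty) (x : Name) : Spanning T [.var x]
  | unApp {T T' : Ty} {f : Prog} {es : List Exp} (h : Spanning T es)
      (hf : PureProgTy f T T') (hi : IsoProg f)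
      (hd : Module.finrank ℂ T.H = Module.finrank ℂ T'.H) : Spanning T' (es.map (Exp.app f))
  | sum {T₀ T₁ : Ty} {es es' : List Exp} (h₀ : Spanning T₀ es) (h₁ : Spanning T₁ es') :
      Spanning (T₀.sum T₁)
        (es.map (Exp.app (.left T₀ T₁)) ++ es'.map (Exp.app (.right T₀ T₁)))
  | pair {T₀ T₁ : Ty} (L : List (Exp × List Exp)) (h₀ : Spanning T₀ (L.map Prod.fst))
      (h₁ : ∀ p ∈ L, Spanning T₁ p.2)
      (hfv : ∀ p ∈ L, ∀ e' ∈ p.2, Disjoint p.1.fv e'.fv) :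
      Spanning (T₀.prod T₁) (L.flatMap fun p => p.2.map (Exp.pair p.1))

/-- Derivations of the isometry judgment `iso(e)` for expressions. -/
inductive IsoExp : Exp → Type
  | unit : IsoExp .unit
  | var (x : Name) : IsoExp (.var x)
  | pair {e₀ e₁ : Exp} (h₀ : IsoExp e₀) (h₁ : IsoExp e₁) : IsoExp (.pair e₀ e₁)
  | ctrl {e : Exp} {T T' : Ty} {n : ℕ} {lhs rhs : Fin n → Exp} (hc : e.Classical)
      (he : IsoExp e) (hs : Spanning T (List.ofFn lhs)) (hr : ∀ j, IsoExp (rhs j)) :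
      IsoExp (.ctrl e T n lhs rhs T')
  | mtch {e : Exp} {T T' : Ty} {n : ℕ} {lhs rhs : Fin n → Exp} (hc : e.Classical)
      (he : IsoExp e) (hs : Spanning T (List.ofFn lhs)) (hr : ∀ j, IsoExp (rhs j)) :
      IsoExp (.mtch e T n lhs rhs T')
  | try_ {e₀ : Exp} (e₁ : Exp) (h : IsoExp e₀) : IsoExp (.trycatch e₀ e₁)
  | catch_ (e₀ : Exp) {e₁ : Exp} (h : IsoExp e₁) : IsoExp (.trycatch e₀ e₁)
  | app {f : Prog} {e : Exp} (hf : IsoProg f) (he : IsoExp e) : IsoExp (.app f e)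

/-- Derivations of the isometry judgment `iso(f)` for programs. -/
inductive IsoProg : Prog → Type
  | u3 (rθ rφ rl : ℝ) : IsoProg (.u3 rθ rφ rl)
  | left (T₀ T₁ : Ty) : IsoProg (.left T₀ T₁)
  | right (T₀ T₁ : Ty) : IsoProg (.right T₀ T₁)
  | lam {e : Exp} {T : Ty} {e' : Exp} (hs : Spanning T [e]) (h : IsoExp e') :
      IsoProg (.lam e T e')
  | rphase (T : Ty) {e : Exp} (r r' : ℝ) (h : IsoExp e) : IsoProg (.rphase T e r r')
  | pmatch {T T' : Ty} {n : ℕ} {lhs rhs : Fin n → Exp} (hs : Spanning T (List.ofFn lhs))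
      (hr : ∀ j, IsoExp (rhs j)) : IsoProg (.pmatch T n lhs rhs T')

end

/-! ## Semantics

An operator between the spaces `ℋ(·)` is given by its matrix `M v τ = ⟨v| M |τ⟩` in the bases above;
`ketbra τ τ'` is the matrix of `|τ⟩⟨τ'|`. -/

/-- The operator `|τ⟩⟨τ'|`. -/
def ketbra {ι : Type} [DecidableEq ι] (τ τ' : ι) : Matrix ι ι ℂ := Matrix.single τ τ' 1

/-- The superoperator that is the linear extension of `|τ⟩⟨τ'| ↦ F τ τ'`. -/
def linExt {ι κ : Type} [Fintype ι] (F : ι → ι → Matrix κ κ ℂ) :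
    Matrix ι ι ℂ →ₗ[ℂ] Matrix κ κ ℂ where
  toFun ρ := ∑ τ, ∑ τ', ρ τ τ' • F τ τ'
  map_add' ρ ρ' := by simp only [Matrix.add_apply, add_smul, Finset.sum_add_distrib]
  map_smul' c ρ := by
    simp only [Matrix.smul_apply, smul_eq_mul, mul_smul, Finset.smul_sum, RingHom.id_apply]

/-- The matrix of the gate `u3`. -/
def u3Matrix (rθ rφ rl : ℝ) : Matrix Ty.bit.Val Ty.bit.Val ℂ
  | .left _, .left _ => (Real.cos (rθ / 2) : ℂ)
  | .right _, .left _ => Complex.exp (Complex.I * rφ) * (Real.sin (rθ / 2) : ℂ)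
  | .left _, .right _ => -Complex.exp (Complex.I * rl) * (Real.sin (rθ / 2) : ℂ)
  | .right _, .right _ => Complex.exp (Complex.I * (rφ + rl)) * (Real.cos (rθ / 2) : ℂ)

/-- The matrix of the left injection `ℋ(T₀) → ℋ(T₀ ⊕ T₁)`. -/
def leftMatrix (T₀ T₁ : Ty) : Matrix (T₀.sum T₁).Val T₀.Val ℂ
  | .left v, w => if v = w then 1 else 0
  | .right _, _ => 0

/-- The matrix of the right injection `ℋ(T₁) → ℋ(T₀ ⊕ T₁)`. -/
def rightMatrix (T₀ T₁ : Ty) : Matrix (T₀.sum T₁).Val T₁.Val ℂ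
  | .left _, _ => 0
  | .right v, w => if v = w then 1 else 0

/-- The operator `A ⊗ B` on `ℋ(T₀ ⊗ T₁)`. -/
def tensor {T₀ T₁ : Ty} (A : Matrix T₀.Val T₀.Val ℂ) (B : Matrix T₁.Val T₁.Val ℂ) :
    Matrix (T₀.prod T₁).Val (T₀.prod T₁).Val ℂ
  | .pair v₀ v₁, .pair w₀ w₁ => A v₀ w₀ * B v₁ w₁

mutual

/-- `⟦σ : Γ ∥ Δ ⊢ e : T⟧`, an operator `ℋ(Δ) → ℋ(T)`. -/
def PureTy.sem {Γ Δ : Ctx} {e : Exp} {T : Ty} :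
    PureTy Γ Δ e T → Γ.Valn → Matrix T.Val Δ.Valn ℂ
  | .unit _, _ => fun _ _ => 1
  | .cvar _ x T hx, σ => fun v _ => if v = σ ⟨(x, T), hx⟩ then 1 else 0
  | .qvar _ x T _, _ => fun v τ =>
      if v = τ ⟨(x, T), Ctx.mem_single x T⟩ then 1 else 0
  | .pair hΔ h₀ h₁, σ => fun v τ =>
      match v with
      | .pair v₀ v₁ => h₀.sem σ v₀ (Valn.res hΔ.left τ) * h₁.sem σ v₁ (Valn.res hΔ.right τ)
  | .ctrl _ _ hΔ he _ hl _ _ hΓ hr, σ => fun v' τ =>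
      ∑ v, he.sem σ (ketbra (Valn.res hΔ.left τ) (Valn.res hΔ.left τ)) v v *
        ∑ j, ∑ σj, ((hl j).sem Valn.empty).conjTranspose σj v *
          (hr j).sem (Valn.append (hΓ j) σ σj) v' τ
  | .app hf he, σ => hf.sem * he.sem σ

/-- `⟦σ : Γ ∥ Δ ⊩ e : T⟧`, a superoperator `ℒ(ℋ(Δ)) → ℒ(ℋ(T))`. -/
def MixTy.sem {Γ Δ : Ctx} {e : Exp} {T : Ty} :
    MixTy Γ Δ e T → Γ.Valn → (Matrix Δ.Valn Δ.Valn ℂ →ₗ[ℂ] Matrix T.Val T.Val ℂ)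
  | .mix h, σ => linExt fun τ τ' => h.sem σ * ketbra τ τ' * (h.sem σ).conjTranspose
  | .discard hΔ h, σ => linExt fun τ τ' =>
      (ketbra (Valn.res hΔ.right τ) (Valn.res hΔ.right τ')).trace •
        h.sem σ (ketbra (Valn.res hΔ.left τ) (Valn.res hΔ.left τ'))
  | .pair hΔ h₀ h₁, σ => linExt fun τ τ' =>
      tensor (h₀.sem σ (ketbra (Valn.res hΔ.left τ) (Valn.res hΔ.left τ')))
        (h₁.sem σ (ketbra (Valn.res hΔ.right τ) (Valn.res hΔ.right τ')))
  | .trycatch hΔ h₀ h₁, σ => linExt fun τ τ' =>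
      (ketbra (Valn.res hΔ.right τ) (Valn.res hΔ.right τ')).trace •
          h₀.sem σ (ketbra (Valn.res hΔ.left τ) (Valn.res hΔ.left τ')) +
        ((ketbra (Valn.res hΔ.left τ) (Valn.res hΔ.left τ')).trace -
            (h₀.sem σ (ketbra (Valn.res hΔ.left τ) (Valn.res hΔ.left τ'))).trace) •
          h₁.sem σ (ketbra (Valn.res hΔ.right τ) (Valn.res hΔ.right τ'))
  | .app hf he, σ => hf.sem ∘ₗ he.sem σ
  | .mtch _ _ hΔ he _ hl _ hΓ hr, σ => linExt fun τ τ' =>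
      ∑ v, he.sem σ (ketbra (Valn.res hΔ.left τ) (Valn.res hΔ.left τ')) v v •
        ∑ j, ∑ σj, ((hl j).sem Valn.empty).conjTranspose σj v •
          (hr j).sem (Valn.append (hΓ j) σ σj)
            (ketbra (Valn.res hΔ.right τ) (Valn.res hΔ.right τ'))

/-- `⟦⊢ f : T ⇝ T'⟧`, an operator `ℋ(T) → ℋ(T')`. -/
def PureProgTy.sem {f : Prog} {T T' : Ty} : PureProgTy f T T' → Matrix T'.Val T.Val ℂ
  | .u3 rθ rφ rl => u3Matrix rθ rφ rl
  | .left T₀ T₁ => leftMatrix T₀ T₁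
  | .right T₀ T₁ => rightMatrix T₀ T₁
  | .lam h h' => h'.sem Valn.empty * (h.sem Valn.empty).conjTranspose
  | .rphase r r' h =>
      Complex.exp (Complex.I * r) • (h.sem Valn.empty * (h.sem Valn.empty).conjTranspose) +
        Complex.exp (Complex.I * r') •
          (1 - h.sem Valn.empty * (h.sem Valn.empty).conjTranspose)
  | .pmatch _ _ hl _ hr =>
      ∑ j, (hr j).sem Valn.empty * ((hl j).sem Valn.empty).conjTranspose

/-- `⟦⊢ f : T ⇛ T'⟧`, a superoperator `ℒ(ℋ(T)) → ℒ(ℋ(T'))`. -/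
def MixProgTy.sem {f : Prog} {T T' : Ty} :
    MixProgTy f T T' → (Matrix T.Val T.Val ℂ →ₗ[ℂ] Matrix T'.Val T'.Val ℂ)
  | .channel h => linExt fun v v' => h.sem * ketbra v v' * h.sem.conjTranspose
  | .lam h h' => linExt fun v v' =>
      h'.sem Valn.empty ((h.sem Valn.empty).conjTranspose * ketbra v v' * h.sem Valn.empty)

end

end Qunity

end

noncomputable section

namespace Qunity

open Matrix

/-! ## Zero-one vectors and partial injections -/

-- All four claims are proved together by induction on the size of the syntax (`Exp.rank`,
-- `Prog.rank`), for all typing derivations of a term at once. Most cases are algebra: isometries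
-- compose and tensor, and different phases on a projector and its complement give a unitary. For
-- `λ`, `match` and `pmatch` one needs that spanning patterns resolve the identity. The matrix of
-- all pattern columns is an isometry, and a dimension count (`Spanning.sum_patDim`,
-- `Spanning.card_valn`) makes it square, hence unitary.
--
-- The hard case is `ctrl`, whose coefficients are diagonal entries of the mixed semantics of the
-- scrutinee. A classical scrutinee sends a basis state to a basis state or to zero
-- (`MixTy.diag_of_below`), and classical orthogonal patterns match a value at most once
-- (`branch_oneHot`). So on a basis vector `ctrl` vanishes or acts as a single branch, chosen by the
-- part that the scrutinee consumes (`PureTy.sem_ctrl_branch`); if the scrutinee is an isometry and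
-- the patterns span, some branch is always chosen. Basis vectors with the same consumed part go
-- through the same isometric branch. Those with different consumed parts have orthogonal images,
-- because erasure lets the consumed variables be read off from the result (`Erases.exists_value`).
--
-- Erasure is a judgment about bare expressions, while the semantics follows derivations. The bridge
-- is `Exp.amp`, an amplitude defined without derivations, which agrees with the pure semantics of
-- every classical or isometric term (`PureTy.sem_eq_amp`). Hence that semantics does not depend on
-- the derivation. Orthogonality of `f e₁` and `f e₂`, where `f` may be typed in two ways, needs
-- this too, which is why the induction hypothesis covers all derivations of smaller terms.

/-- A vector that is zero or a standard basis vector. -/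
structure OneHot {ι : Type} (f : ι → ℂ) : Prop where
  val : ∀ i, f i = 0 ∨ f i = 1
  uniq : ∀ i j, f i ≠ 0 → f j ≠ 0 → i = j

namespace OneHot

variable {ι κ : Type}

theorem eq_zero_or_single [DecidableEq ι] {f : ι → ℂ} (h : OneHot f) :
    f = 0 ∨ ∃ i, f = Pi.single i 1 := by
  by_cases h0 : f = 0
  · exact .inl h0
  · obtain ⟨i, hi⟩ := Function.ne_iff.mp h0
    refine .inr ⟨i, funext fun j => ?_⟩
    by_cases hij : j = i
    · subst hij; simpa using (h.val j).resolve_left hi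
    · rw [Pi.single_eq_of_ne hij]
      by_contra hj
      exact hij (h.uniq _ _ hj hi)

theorem zero : OneHot (0 : ι → ℂ) := ⟨fun _ => .inl rfl, fun _ _ h => absurd rfl h⟩

theorem single [DecidableEq ι] (i : ι) : OneHot (Pi.single i 1 : ι → ℂ) where
  val j := by by_cases h : j = i <;> simp [h]
  uniq j k hj hk := by
    simp only [Pi.single_apply, ne_eq, ite_eq_right_iff, one_ne_zero, imp_false, not_not] at hj hk
    rw [hj, hk]

theorem star_eq {f : ι → ℂ} (h : OneHot f) (i : ι) : star (f i) = f i := by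
  rcases h.val i with h | h <;> simp [h]

theorem star {f : ι → ℂ} (h : OneHot f) : OneHot (fun i => star (f i)) := by
  simpa only [h.star_eq] using h

/-- One-hot weights either kill the sum or select a single `F s`. Products of partial injections and
the choice of a branch are both instances. -/
theorem comb [Fintype κ] {w : κ → ℂ} (hw : OneHot w) {F : κ → ι → ℂ} (hF : ∀ s, OneHot (F s)) :
    OneHot fun i => ∑ s, w s * F s i := by
  classical
  rcases hw.eq_zero_or_single with h | ⟨s, h⟩
  · simp only [h, Pi.zero_apply, zero_mul, Finset.sum_const_zero]
    exact OneHot.zero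
  · simpa [h, Pi.single_apply] using hF s

/-- Zero-one entries equal their squared moduli, so a norm statement obtained from unitarity becomes
one about the weights themselves, which occur unsquared in `ctrl` and `match`. -/
theorem sum_eq_one [Fintype ι] {f : ι → ℂ} (h : OneHot f) (h1 : ∑ i, f i * Star.star (f i) = 1) :
    ∑ i, f i = 1 := by
  rw [← h1]
  refine Finset.sum_congr rfl fun i _ => ?_
  rcases h.val i with h | h <;> simp [h]

theorem exists_single [Fintype ι] [DecidableEq ι] {f : ι → ℂ} (h : OneHot f)
    (h1 : ∑ i, f i = 1) : ∃ i, f = Pi.single i 1 := by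
  rcases h.eq_zero_or_single with h | h
  · simp [h] at h1
  · exact h

theorem vecMulVec [DecidableEq ι] {f : ι → ℂ} (h : OneHot f) :
    (Matrix.of fun i j => f i * Star.star (f j)) = Matrix.diagonal f := by
  ext i j
  rw [Matrix.of_apply, h.star_eq]
  by_cases hij : i = j
  · subst hij
    rcases h.val i with h | h <;> simp [h]
  · rw [Matrix.diagonal_apply_ne _ hij]
    by_contra hne
    exact hij (h.uniq _ _ (left_ne_zero_of_mul hne) (right_ne_zero_of_mul hne))

end OneHot

/-- The matrix of a partial injection between bases. -/
structure PInj {ι κ : Type} (M : Matrix ι κ ℂ) : Prop where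
  col : ∀ j, OneHot fun i => M i j
  row : ∀ i, OneHot fun j => M i j

namespace PInj

variable {ι κ μ : Type}

theorem conjTranspose {M : Matrix ι κ ℂ} (h : PInj M) : PInj Mᴴ :=
  ⟨fun j => (h.row j).star, fun i => (h.col i).star⟩

theorem mul [Fintype κ] {M : Matrix ι κ ℂ} {N : Matrix κ μ ℂ} (hM : PInj M) (hN : PInj N) :
    PInj (M * N) where
  col j := by
    simpa only [Matrix.mul_apply, mul_comm] using
      (hN.col j).comb (F := fun s i => M i s) fun s => hM.col s
  row i := by
    simpa only [Matrix.mul_apply] using (hM.row i).comb (F := fun s j => N s j) fun s => hN.row s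

theorem of_entries {M : Matrix ι κ ℂ} (h01 : ∀ i j, M i j = 0 ∨ M i j = 1)
    (hc : ∀ i i' j, M i j ≠ 0 → M i' j ≠ 0 → i = i')
    (hr : ∀ i j j', M i j ≠ 0 → M i j' ≠ 0 → j = j') : PInj M :=
  ⟨fun j => ⟨fun i => h01 i j, fun i i' => hc i i' j⟩, fun i => ⟨h01 i, hr i⟩⟩

end PInj

/-- In a family of partial injections with orthogonal ranges, the combined rows are zero or basis
vectors. -/
theorem oneHot_sigma {ι J : Type} {κ : J → Type} [Fintype ι]
    {L : (j : J) → Matrix ι (κ j) ℂ} (hL : ∀ j, PInj (L j))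
    (ho : ∀ j k, j ≠ k → (L j)ᴴ * L k = 0) (i : ι) :
    OneHot fun s : (j : J) × κ j => L s.1 i s.2 where
  val s := ((hL s.1).row i).val s.2
  uniq := by
    rintro ⟨j, a⟩ ⟨k, b⟩ ha hb
    by_cases hjk : j = k
    · subst hjk
      rw [((hL j).row i).uniq a b ha hb]
    · exfalso
      -- Column `a` of `L j` is supported at `i` only, so this entry of the vanishing product is a
      -- single term, the product of two nonzero numbers.
      have h := congrFun (congrFun (ho j k hjk) a) b
      rw [Matrix.mul_apply, Matrix.zero_apply, Finset.sum_eq_single i] at h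
      · exact (mul_ne_zero (star_ne_zero.mpr ha) hb) h
      · intro i' _ hi'
        by_contra hne
        exact hi' (((hL j).col a).uniq _ _
          (star_ne_zero.mp (left_ne_zero_of_mul hne)) ha)
      · simp

/-- Over pairs of a branch and a column index, a row of the combined `L` is one-hot by orthogonality
and selects one column of one `R`; rows are symmetric. This is the shape of `pmatch`. -/
theorem PInj.sum_mul {ι μ J : Type} [Fintype J] {κ : J → Type} [∀ j, Fintype (κ j)]
    [Fintype ι] [Fintype μ] {L : (j : J) → Matrix ι (κ j) ℂ} {R : (j : J) → Matrix μ (κ j) ℂ}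
    (hL : ∀ j, PInj (L j)) (hoL : ∀ j k, j ≠ k → (L j)ᴴ * L k = 0)
    (hR : ∀ j, PInj (R j)) (hoR : ∀ j k, j ≠ k → (R j)ᴴ * R k = 0) :
    PInj (∑ j, R j * (L j)ᴴ) := by
  have key : ∀ i i', (∑ j, R j * (L j)ᴴ) i i' =
      ∑ s : (j : J) × κ j, star (L s.1 i' s.2) * R s.1 i s.2 := fun i i' => by
    simp [Matrix.sum_apply, Matrix.mul_apply, Fintype.sum_sigma, mul_comm]
  constructor
  · intro i'
    simpa only [key] using (oneHot_sigma hL hoL i').star.comb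
      (F := fun s i => R s.1 i s.2) fun s => (hR s.1).col s.2
  · intro i
    simpa only [key, mul_comm] using (oneHot_sigma hR hoR i).comb
      (F := fun s i' => star (L s.1 i' s.2)) fun s => ((hL s.1).col s.2).star

/-! ## Superoperators -/

theorem linExt_ketbra {ι κ : Type} [Fintype ι] [DecidableEq ι] (F : ι → ι → Matrix κ κ ℂ)
    (τ τ' : ι) : linExt F (ketbra τ τ') = F τ τ' := by
  change ∑ a, ∑ b, ketbra τ τ' a b • F a b = _
  rw [Finset.sum_eq_single τ, Finset.sum_eq_single τ'] <;>
    simp +contextual [ketbra, Matrix.single_apply, eq_comm]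

theorem trace_ketbra {ι : Type} [Fintype ι] [DecidableEq ι] (τ τ' : ι) :
    (ketbra τ τ').trace = if τ = τ' then 1 else 0 := by
  by_cases h : τ = τ'
  · subst h; simp [ketbra]
  · simp [ketbra, h]

theorem trace_linExt {ι κ : Type} [Fintype ι] [DecidableEq ι] [Fintype κ]
    {F : ι → ι → Matrix κ κ ℂ} (hF : ∀ τ τ', (F τ τ').trace = if τ = τ' then 1 else 0)
    (ρ : Matrix ι ι ℂ) : (linExt F ρ).trace = ρ.trace := by
  change (∑ a, ∑ b, ρ a b • F a b).trace = _
  simp only [Matrix.trace_sum, Matrix.trace_smul, hF]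
  simp [Matrix.trace]

theorem mul_ketbra_mul {ι κ : Type} [Fintype ι] [DecidableEq ι] (M : Matrix κ ι ℂ) (τ τ' : ι) :
    M * ketbra τ τ' * Mᴴ = Matrix.of fun v w => M v τ * star (M w τ') := by
  ext v w
  simp [ketbra, Matrix.mul_apply, Matrix.single_apply, ite_and]

theorem trace_mul_ketbra_mul {ι κ : Type} [Fintype ι] [DecidableEq ι] [Fintype κ]
    {M : Matrix κ ι ℂ} (hM : Mᴴ * M = 1) (τ τ' : ι) :
    (M * ketbra τ τ' * Mᴴ).trace = if τ = τ' then 1 else 0 := by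
  rw [Matrix.trace_mul_comm, ← Matrix.mul_assoc, hM, Matrix.one_mul, trace_ketbra]

theorem PInj.mul_ketbra_mul {ι κ : Type} [Fintype ι] [DecidableEq ι] [DecidableEq κ]
    {M : Matrix κ ι ℂ} (hM : PInj M) (τ : ι) :
    M * ketbra τ τ * Mᴴ = Matrix.diagonal fun v => M v τ := by
  rw [Qunity.mul_ketbra_mul, (hM.col τ).vecMulVec]

theorem trace_tensor {T₀ T₁ : Ty} (A : Matrix T₀.Val T₀.Val ℂ) (B : Matrix T₁.Val T₁.Val ℂ) :
    (tensor A B).trace = A.trace * B.trace := by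
  rw [Matrix.trace, ← (Ty.Val.prodEquiv T₀ T₁).symm.sum_comp, Fintype.sum_prod_type]
  simp only [Matrix.trace, Finset.sum_mul_sum]
  rfl

/-! ## Environments -/

/-- Values together with their types. -/
abbrev UVal : Type := (T : Ty) × T.Val

/-- Environments: partial assignments of typed values to names. -/
abbrev Env : Type := Name → Option UVal

/-- The environments defined exactly on `S`. -/
def Env.on (S : Finset Name) : Set Env := {env | ∀ x, (env x).isSome ↔ x ∈ S}

/-- The environment `env'` on its domain, and `env` elsewhere. -/
def Env.override (env' env : Env) : Env := fun x => (env' x).or (env x)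

theorem Env.override_of_none {env' env : Env} {x : Name} (h : env' x = none) :
    env'.override env x = env x := by simp [Env.override, h]

theorem Env.override_of_some {env' env : Env} {x : Name} {u : UVal} (h : env' x = some u) :
    env'.override env x = some u := by simp [Env.override, h]

theorem Env.eq_none_of_on {S : Finset Name} {env : Env} (h : env ∈ Env.on S) {x : Name}
    (hx : x ∉ S) : env x = none := by
  rw [← Option.not_isSome_iff_eq_none, h x]; exact hx

theorem Ctx.mem_dom {Δ : Ctx} {x : Name} : x ∈ Δ.dom ↔ ∃ T, (x, T) ∈ Δ.binds := by
  simp [Ctx.dom]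

theorem Ctx.mem_dom_of_mem {Δ : Ctx} {x : Name} {T : Ty} (h : (x, T) ∈ Δ.binds) : x ∈ Δ.dom :=
  Ctx.mem_dom.mpr ⟨T, h⟩

theorem Ctx.type_unique {Δ : Ctx} {x : Name} {T T' : Ty} (h : (x, T) ∈ Δ.binds)
    (h' : (x, T') ∈ Δ.binds) : T = T' :=
  congrArg Prod.snd (Δ.unique _ h _ h' rfl)

theorem Ctx.notMem_empty {p : Name × Ty} : p ∉ Ctx.empty.binds := Finset.notMem_empty p

theorem Ctx.dom_empty : Ctx.empty.dom = ∅ := rfl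

theorem IsSplit.disjoint_dom {Δ Δ₀ Δ₁ : Ctx} (h : IsSplit Δ Δ₀ Δ₁) : Disjoint Δ₀.dom Δ₁.dom := by
  rw [Finset.disjoint_left]
  intro x h₀ h₁
  obtain ⟨T, hT⟩ := Ctx.mem_dom.mp h₀
  obtain ⟨T', hT'⟩ := Ctx.mem_dom.mp h₁
  obtain rfl := Ctx.type_unique (h.left hT) (h.right hT')
  exact Finset.disjoint_left.mp h.disj hT hT'

theorem IsSplit.mem_dom {Δ Δ₀ Δ₁ : Ctx} (h : IsSplit Δ Δ₀ Δ₁) {x : Name} :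
    x ∈ Δ.dom ↔ x ∈ Δ₀.dom ∨ x ∈ Δ₁.dom := by
  simp [Ctx.dom, h.eq, Finset.image_union]

theorem IsJoin.mem_dom {Δ Δ₀ Δ₁ : Ctx} (h : IsJoin Δ Δ₀ Δ₁) {x : Name} :
    x ∈ Δ.dom ↔ x ∈ Δ₀.dom ∨ x ∈ Δ₁.dom := by
  simp [Ctx.dom, h.eq, Finset.image_union]

open Classical in
/-- The environment of a valuation. -/
def Ctx.Valn.env {Δ : Ctx} (τ : Δ.Valn) : Env := fun x =>
  if h : ∃ T, (x, T) ∈ Δ.binds then some ⟨h.choose, τ ⟨(x, h.choose), h.choose_spec⟩⟩ else none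

theorem Ctx.Valn.env_of_mem {Δ : Ctx} (τ : Δ.Valn) {x : Name} {T : Ty} (h : (x, T) ∈ Δ.binds) :
    τ.env x = some ⟨T, τ ⟨(x, T), h⟩⟩ := by
  have hex : ∃ T, (x, T) ∈ Δ.binds := ⟨T, h⟩
  have key : ∀ T' (h' : (x, T') ∈ Δ.binds),
      (⟨T', τ ⟨(x, T'), h'⟩⟩ : UVal) = ⟨T, τ ⟨(x, T), h⟩⟩ := by
    intro T' h'
    obtain rfl := Ctx.type_unique h h'
    rfl
  rw [Ctx.Valn.env, dif_pos hex, key]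

theorem Ctx.Valn.env_of_notMem {Δ : Ctx} (τ : Δ.Valn) {x : Name} (h : x ∉ Δ.dom) :
    τ.env x = none := by
  rw [Ctx.Valn.env, dif_neg fun hex => h (Ctx.mem_dom.mpr hex)]

theorem Ctx.Valn.env_injective (Δ : Ctx) : Function.Injective (Ctx.Valn.env (Δ := Δ)) := by
  intro τ τ' h
  funext ⟨⟨x, T⟩, hp⟩
  have := congrFun h x
  rw [τ.env_of_mem hp, τ'.env_of_mem hp] at this
  simpa using this

theorem Ctx.Valn.env_mem_on {Δ : Ctx} (τ : Δ.Valn) : τ.env ∈ Env.on Δ.dom := by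
  intro x
  by_cases hx : x ∈ Δ.dom
  · obtain ⟨T, hT⟩ := Ctx.mem_dom.mp hx
    simp [τ.env_of_mem hT, hx]
  · simp [τ.env_of_notMem hx, hx]

/-- `env` contains the bindings of `σ`, and those of `τ` that `σ` does not shadow. -/
structure Env.Extends {Γ Δ : Ctx} (env : Env) (σ : Γ.Valn) (τ : Δ.Valn) : Prop where
  cl : ∀ (x : Name) (T : Ty) (h : (x, T) ∈ Γ.binds), env x = some ⟨T, σ ⟨(x, T), h⟩⟩
  qu : ∀ (x : Name) (T : Ty) (h : (x, T) ∈ Δ.binds), x ∉ Γ.dom →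
    env x = some ⟨T, τ ⟨(x, T), h⟩⟩

/-- Every pair of valuations is covered by some environment, so facts about amplitudes can be
applied to given `σ` and `τ`. -/
theorem Env.extends_override {Γ Δ : Ctx} (σ : Γ.Valn) (τ : Δ.Valn) :
    (σ.env.override τ.env).Extends σ τ where
  cl _ _ h := Env.override_of_some (σ.env_of_mem h)
  qu x T h hx := by rw [Env.override_of_none (σ.env_of_notMem hx), τ.env_of_mem h]

theorem Env.Extends.res {Γ Δ Δ₀ : Ctx} {env : Env} {σ : Γ.Valn} {τ : Δ.Valn}
    (h : env.Extends σ τ) (hs : Δ₀.binds ⊆ Δ.binds) : env.Extends σ (Valn.res hs τ) :=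
  ⟨h.cl, fun x T hx => h.qu x T (hs hx)⟩

theorem Env.extends_env {Δ : Ctx} (τ : Δ.Valn) : τ.env.Extends Valn.empty τ :=
  ⟨fun _ _ h => absurd h Ctx.notMem_empty, fun _ _ h _ => τ.env_of_mem h⟩

/-- Pattern variables are disjoint from `Γ` but may clash with names of `Δ`; such clashes are the
reason why `Env.Extends` exempts shadowed quantum variables. -/
theorem Env.Extends.append {Γ Γ' Γ₁ Δ : Ctx} {env : Env} {σ : Γ.Valn} {τ : Δ.Valn}
    (h : env.Extends σ τ) (hΓ : IsSplit Γ' Γ Γ₁) (σ₁ : Γ₁.Valn) :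
    (σ₁.env.override env).Extends (Valn.append hΓ σ σ₁) τ where
  cl x T hx := by
    by_cases h₀ : (x, T) ∈ Γ.binds
    · have hn : x ∉ Γ₁.dom := Finset.disjoint_left.mp hΓ.disjoint_dom (Ctx.mem_dom_of_mem h₀)
      rw [Env.override_of_none (σ₁.env_of_notMem hn), h.cl x T h₀]
      simp [Valn.append, h₀]
    · have h₁ : (x, T) ∈ Γ₁.binds := (Finset.mem_union.mp (hΓ.eq ▸ hx)).resolve_left h₀
      rw [Env.override_of_some (σ₁.env_of_mem h₁)]
      simp [Valn.append, h₀]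
  qu x T hx hn := by
    rw [hΓ.mem_dom, not_or] at hn
    rw [Env.override_of_none (σ₁.env_of_notMem hn.2), h.qu x T hx hn.1]

/-! ## Amplitudes -/

/-- The argument type of a program. -/
def Prog.src : Prog → Ty
  | .u3 _ _ _ => Ty.bit
  | .left T₀ _ => T₀
  | .right _ T₁ => T₁
  | .lam _ T _ => T
  | .rphase T _ _ _ => T
  | .pmatch T _ _ _ _ => T

/-- Amplitudes of a pair. -/
def pairAmp (a₀ a₁ : (T : Ty) → T.Val → ℂ) : (T : Ty) → T.Val → ℂ
  | .prod T₀ T₁, .pair v₀ v₁ => a₀ T₀ v₀ * a₁ T₁ v₁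
  | _, _ => 0

mutual
/-- The amplitude with which `e` has the value `v : T` when the variables have the values given by
`env`; no reference is made to a typing derivation. -/
def Exp.amp : Exp → Env → (T : Ty) → T.Val → ℂ
  | .unit, _, T, _ => if T = .unit then 1 else 0
  | .var x, env, T, v => if env x = some ⟨T, v⟩ then 1 else 0
  | .pair e₀ e₁, env, T, v => pairAmp (e₀.amp env) (e₁.amp env) T v
  | .ctrl e T n lhs rhs _, env, T', v' =>
    ∑ v : T.Val, e.amp env T v * ∑ j : Fin n, ∑ᶠ env' ∈ Env.on (lhs j).fv,
      star ((lhs j).amp env' T v) * (rhs j).amp (env'.override env) T' v'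
  | .mtch e T n lhs rhs _, env, T', v' =>
    ∑ v : T.Val, e.amp env T v * ∑ j : Fin n, ∑ᶠ env' ∈ Env.on (lhs j).fv,
      star ((lhs j).amp env' T v) * (rhs j).amp (env'.override env) T' v'
  | .trycatch e₀ e₁, env, T, v =>
    e₀.amp env T v + (1 - ∑ w, e₀.amp env T w) * e₁.amp env T v
  | .app f e, env, T', v' => ∑ v : f.src.Val, f.amp f.src T' v v' * e.amp env f.src v
/-- The amplitude with which `f` sends `v : T` to `v' : T'`. -/
def Prog.amp : Prog → (T T' : Ty) → T.Val → T'.Val → ℂ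
  | .u3 rθ rφ rl, T, T', v, v' =>
    if h : T = Ty.bit ∧ T' = Ty.bit then u3Matrix rθ rφ rl (h.2 ▸ v') (h.1 ▸ v) else 0
  | .left T₀ T₁, T, T', v, v' =>
    if h : T = T₀ ∧ T' = T₀.sum T₁ then leftMatrix T₀ T₁ (h.2 ▸ v') (h.1 ▸ v) else 0
  | .right T₀ T₁, T, T', v, v' =>
    if h : T = T₁ ∧ T' = T₀.sum T₁ then rightMatrix T₀ T₁ (h.2 ▸ v') (h.1 ▸ v) else 0
  | .lam e _ e', T, T', v, v' =>
    ∑ᶠ env ∈ Env.on e.fv, star (e.amp env T v) * e'.amp env T' v'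
  | .rphase _ e r r', T, T', v, v' =>
    if h : T' = T then
      Complex.exp (Complex.I * r) *
          ∑ᶠ env ∈ Env.on e.fv, star (e.amp env T v) * e.amp env T (h ▸ v') +
        Complex.exp (Complex.I * r') * ((1 : Matrix T.Val T.Val ℂ) (h ▸ v') v -
          ∑ᶠ env ∈ Env.on e.fv, star (e.amp env T v) * e.amp env T (h ▸ v'))
    else 0
  | .pmatch _ n lhs rhs _, T, T', v, v' =>
    ∑ j : Fin n, ∑ᶠ env ∈ Env.on (lhs j).fv, star ((lhs j).amp env T v) * (rhs j).amp env T' v'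
end

/-- The intermediate type in `f e` is not part of the typing judgment of `f e`, but it is forced by
the syntax of `f`; amplitudes of applications rely on this. -/
theorem PureProgTy.src_eq {f : Prog} {T T' : Ty} (h : PureProgTy f T T') : f.src = T := by
  cases h <;> rfl

theorem MixProgTy.src_eq {f : Prog} {T T' : Ty} (h : MixProgTy f T T') : f.src = T := by
  cases h with
  | channel h => exact h.src_eq
  | lam => rfl

theorem Exp.amp_app {f : Prog} {T : Ty} (hf : f.src = T) (e : Exp) (env : Env) (T' : Ty)
    (v' : T'.Val) :
    (Exp.app f e).amp env T' v' = ∑ v : T.Val, f.amp T T' v v' * e.amp env T v := by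
  subst hf; rw [Exp.amp]

/-! ## Free variables and contexts -/

/-- In general a context may contain names that do not occur in the expression, as for a `ctrl`
without branches. Orthogonal patterns are built from variables, `()`, pairs and applications only,
which excludes this. Consequently every variable that a pattern adds to the context of a branch is
removed again in `Exp.fv`. -/
theorem Ortho.dom_sub : ∀ {T : Ty} {es : List Exp}, Ortho T es → ∀ e ∈ es, ∀ {Δ : Ctx},
    PureTy Ctx.empty Δ e T → Δ.dom ⊆ e.fv
  | _, _, .void, e, he, _, _ => absurd he List.not_mem_nil
  | _, _, .unit, e, he, _, h => by
    obtain rfl := List.mem_singleton.mp he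
    cases h; simp [Ctx.dom_empty]
  | _, _, .var T x, e, he, _, h => by
    obtain rfl := List.mem_singleton.mp he
    cases h with
    | cvar _ _ _ hx => exact absurd hx Ctx.notMem_empty
    | qvar => simp [Ctx.dom, Ctx.single, Exp.fv]
  | _, _, .isoApp ho hf _, e, he, _, h => by
    obtain ⟨e, hm, rfl⟩ := List.mem_map.mp he
    cases h with
    | app hf' he' =>
      obtain rfl := hf.src_eq.symm.trans hf'.src_eq
      simpa only [Exp.fv] using ho.dom_sub e hm he'
  | _, _, .sum h₀ h₁, e, he, _, h => by
    rcases List.mem_append.mp he with he | he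
    all_goals
      obtain ⟨e, hm, rfl⟩ := List.mem_map.mp he
      cases h with
      | app hf' he' =>
        cases hf'
        simp only [Exp.fv]
        first | exact h₀.dom_sub e hm he' | exact h₁.dom_sub e hm he'
  | _, _, .pair L h₀ h₁ _, e, he, _, h => by
    obtain ⟨p, hp, he⟩ := List.mem_flatMap.mp he
    obtain ⟨e', he', rfl⟩ := List.mem_map.mp he
    cases h with
    | pair hΔ k₀ k₁ =>
      intro x hx
      have i₀ := h₀.dom_sub p.1 (List.mem_map_of_mem hp) k₀
      have i₁ := (h₁ p hp).dom_sub e' he' k₁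
      rw [Exp.fv, Finset.mem_union]
      exact (hΔ.mem_dom.mp hx).imp (@i₀ x) (@i₁ x)
  | _, _, .sub ho hs, e, he, _, h => ho.dom_sub e (hs.subset he) h

theorem Ortho.dom_sub_ofFn {T : Ty} {n : ℕ} {lhs : Fin n → Exp} (h : Ortho T (List.ofFn lhs))
    (j : Fin n) {Δ : Ctx} (hl : PureTy Ctx.empty Δ (lhs j) T) : Δ.dom ⊆ (lhs j).fv :=
  h.dom_sub _ (List.mem_ofFn.mpr ⟨j, rfl⟩) hl

mutual
theorem PureTy.fv_sub {Γ Δ : Ctx} {e : Exp} {T : Ty} :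
    PureTy Γ Δ e T → ∀ x ∈ e.fv, x ∈ Γ.dom ∨ x ∈ Δ.dom
  | .unit _, x, hx => by simp [Exp.fv] at hx
  | .cvar _ y T hy, x, hx => by
    obtain rfl : x = y := by simpa [Exp.fv] using hx
    exact .inl (Ctx.mem_dom_of_mem hy)
  | .qvar _ y T _, x, hx => by
    obtain rfl : x = y := by simpa [Exp.fv] using hx
    exact .inr (Ctx.mem_dom_of_mem (Ctx.mem_single x T))
  | .pair hΔ h₀ h₁, x, hx => by
    rw [hΔ.mem_dom]
    rcases Finset.mem_union.mp (by simpa only [Exp.fv] using hx) with h | h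
    · have := h₀.fv_sub x h; tauto
    · have := h₁.fv_sub x h; tauto
  | .ctrl Γl Γr hΔ he ho hl _ _ hΓ hr, x, hx => by
    rcases Finset.mem_union.mp (by simpa only [Exp.fv] using hx) with h | h
    · rw [hΔ.mem_dom]; have := he.fv_sub x h; tauto
    · obtain ⟨j, -, hj⟩ := Finset.mem_biUnion.mp h
      obtain ⟨hj, hn⟩ := Finset.mem_sdiff.mp hj
      have h₁ := (hr j).fv_sub x hj
      rw [(hΓ j).mem_dom] at h₁
      have h₂ : x ∈ (Γl j).dom → _ := fun h => ho.dom_sub_ofFn j (hl j) h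
      tauto
  | .app _ he, x, hx => he.fv_sub x (by simpa only [Exp.fv] using hx)
theorem MixTy.fv_sub {Γ Δ : Ctx} {e : Exp} {T : Ty} :
    MixTy Γ Δ e T → ∀ x ∈ e.fv, x ∈ Γ.dom ∨ x ∈ Δ.dom
  | .mix h, x, hx => h.fv_sub x hx
  | .discard hΔ h, x, hx => by rw [hΔ.mem_dom]; have := h.fv_sub x hx; tauto
  | .pair hΔ h₀ h₁, x, hx => by
    rw [hΔ.mem_dom]
    rcases Finset.mem_union.mp (by simpa only [Exp.fv] using hx) with h | h
    · have := h₀.fv_sub x h; tauto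
    · have := h₁.fv_sub x h; tauto
  | .trycatch hΔ h₀ h₁, x, hx => by
    rw [hΔ.mem_dom]
    rcases Finset.mem_union.mp (by simpa only [Exp.fv] using hx) with h | h
    · have := h₀.fv_sub x h; tauto
    · have := h₁.fv_sub x h; tauto
  | .app _ he, x, hx => he.fv_sub x (by simpa only [Exp.fv] using hx)
  | .mtch Γl Γr hΔ he ho hl _ hΓ hr, x, hx => by
    rw [hΔ.mem_dom]
    rcases Finset.mem_union.mp (by simpa only [Exp.fv] using hx) with h | h
    · have := he.fv_sub x h; tauto
    · obtain ⟨j, -, hj⟩ := Finset.mem_biUnion.mp h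
      obtain ⟨hj, hn⟩ := Finset.mem_sdiff.mp hj
      have h₁ := (hr j).fv_sub x hj
      rw [(hΓ j).mem_dom] at h₁
      have h₂ : x ∈ (Γl j).dom → _ := fun h => ho.dom_sub_ofFn j (hl j) h
      tauto
end

/-- A nonzero amplitude has a nonzero path: a scrutinee value, a branch and a binding environment.
-/
theorem exists_branch_ne_zero {n : ℕ} {A : Type} [Fintype A] {c : A → ℂ} {S : Fin n → Set Env}
    {l r : Fin n → A → Env → ℂ}
    (h : ∑ v, c v * ∑ j, ∑ᶠ env' ∈ S j, l j v env' * r j v env' ≠ 0) :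
    ∃ v j, ∃ env' ∈ S j, c v ≠ 0 ∧ l j v env' ≠ 0 ∧ r j v env' ≠ 0 := by
  obtain ⟨v, -, hv⟩ := Finset.exists_ne_zero_of_sum_ne_zero h
  obtain ⟨j, -, hj⟩ := Finset.exists_ne_zero_of_sum_ne_zero (right_ne_zero_of_mul hv)
  obtain ⟨env', he, hne⟩ := exists_ne_zero_of_finsum_mem_ne_zero hj
  exact ⟨v, j, env', he, left_ne_zero_of_mul hv, left_ne_zero_of_mul hne, right_ne_zero_of_mul hne⟩

/-- If `e` has a nonzero amplitude then all quantum variables are free in `e`, are not shadowed, and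
have values of the right type. -/
theorem PureTy.mem_of_amp_ne_zero {Γ Δ : Ctx} {e : Exp} {T : Ty} : PureTy Γ Δ e T →
    ∀ (env : Env) (v : T.Val), e.amp env T v ≠ 0 → ∀ (x : Name) (X : Ty), (x, X) ∈ Δ.binds →
      x ∈ e.fv ∧ x ∉ Γ.dom ∧ ∃ w, env x = some ⟨X, w⟩
  | .unit _, _, _, _, x, X, hX => absurd hX Ctx.notMem_empty
  | .cvar _ _ _ _, _, _, _, x, X, hX => absurd hX Ctx.notMem_empty
  | .qvar _ y T hy, env, v, hne, x, X, hX => by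
    obtain ⟨rfl, rfl⟩ : x = y ∧ X = T := by simpa [Ctx.single] using hX
    refine ⟨by simp [Exp.fv], hy, v, ?_⟩
    by_contra hn
    simp [Exp.amp, hn] at hne
  | .pair hΔ h₀ h₁, env, .pair v₀ v₁, hne, x, X, hX => by
    simp only [Exp.amp, pairAmp, ne_eq, mul_eq_zero, not_or] at hne
    simp only [Exp.fv, Finset.mem_union]
    rw [hΔ.eq, Finset.mem_union] at hX
    rcases hX with hX | hX
    · have := h₀.mem_of_amp_ne_zero env v₀ hne.1 x X hX; tauto
    · have := h₁.mem_of_amp_ne_zero env v₁ hne.2 x X hX; tauto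
  | .ctrl Γl Γr hΔ he ho hl _ _ hΓ hr, env, v, hne, x, X, hX => by
    rw [Exp.amp] at hne
    obtain ⟨-, j, env', henv, -, -, hr0⟩ := exists_branch_ne_zero hne
    obtain ⟨hf, hx, w, hw⟩ := (hr j).mem_of_amp_ne_zero _ v hr0 x X hX
    rw [(hΓ j).mem_dom, not_or] at hx
    -- A variable of the pattern would be classical inside the branch, where `x` is not; so the
    -- branch environment leaves `x` unchanged.
    have hl' := fun h => ((hl j).fv_sub x h).elim (by simp [Ctx.dom_empty]) hx.2
    rw [Env.override_of_none (Env.eq_none_of_on henv hl')] at hw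
    refine ⟨?_, hx.1, w, hw⟩
    rw [Exp.fv, Finset.mem_union, Finset.mem_biUnion]
    exact .inr ⟨j, Finset.mem_univ _, Finset.mem_sdiff.mpr ⟨hf, hl'⟩⟩
  | .app hf he, env, v, hne, x, X, hX => by
    rw [Exp.amp_app hf.src_eq] at hne
    obtain ⟨w, -, hw⟩ := Finset.exists_ne_zero_of_sum_ne_zero hne
    rw [Exp.fv]
    exact he.mem_of_amp_ne_zero env w (right_ne_zero_of_mul hw) x X hX

/-- Sums over the environments that a pattern binds are sums over the valuations of its context. -/
theorem PureTy.finsum_env {Δ : Ctx} {e : Exp} {T : Ty} (h : PureTy Ctx.empty Δ e T) (v : T.Val)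
    (G : Env → ℂ) :
    ∑ᶠ env ∈ Env.on e.fv, star (e.amp env T v) * G env =
      ∑ τ : Δ.Valn, star (e.amp τ.env T v) * G τ.env := by
  have hfv : ∀ x ∈ e.fv, x ∈ Δ.dom := fun x hx =>
    (h.fv_sub x hx).resolve_left (by simp [Ctx.dom_empty])
  set F : Env → ℂ := fun env => star (e.amp env T v) * G env with hF
  have hne : ∀ env, F env ≠ 0 → e.amp env T v ≠ 0 := fun env h0 =>
    star_ne_zero.mp (left_ne_zero_of_mul h0)
  have hdom : ∀ env, F env ≠ 0 → Δ.dom = e.fv := fun env h0 => by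
    ext x
    refine ⟨fun hx => ?_, hfv x⟩
    obtain ⟨X, hX⟩ := Ctx.mem_dom.mp hx
    exact (h.mem_of_amp_ne_zero env v (hne env h0) x X hX).1
  -- The context may have names that are not free in `e`, and `Env.on` allows values of any type. On
  -- the support both differences disappear: the domains agree and every name has its declared type.
  have hset : Env.on e.fv ∩ Function.support F =
      Set.range (Ctx.Valn.env (Δ := Δ)) ∩ Function.support F := by
    ext env
    simp only [Set.mem_inter_iff, Function.mem_support, and_congr_left_iff]
    intro h0
    rw [← hdom env h0]
    constructor
    · intro hon
      have hty : ∀ p : Δ.binds, ∃ w : p.1.2.Val, env p.1.1 = some ⟨p.1.2, w⟩ := fun p =>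
        (h.mem_of_amp_ne_zero env v (hne env h0) p.1.1 p.1.2 p.2).2.2
      obtain ⟨w, hw⟩ : ∃ w : Δ.Valn, ∀ p : Δ.binds, env p.1.1 = some ⟨p.1.2, w p⟩ :=
        ⟨fun p => (hty p).choose, fun p => (hty p).choose_spec⟩
      refine ⟨w, funext fun x => ?_⟩
      by_cases hx : x ∈ Δ.dom
      · obtain ⟨X, hX⟩ := Ctx.mem_dom.mp hx
        rw [Ctx.Valn.env_of_mem _ hX]
        exact (hw ⟨(x, X), hX⟩).symm
      · rw [Ctx.Valn.env_of_notMem _ hx, Env.eq_none_of_on hon hx]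
    · rintro ⟨τ, rfl⟩
      exact τ.env_mem_on
  change ∑ᶠ env ∈ Env.on e.fv, F env = ∑ τ : Δ.Valn, F τ.env
  rw [← finsum_mem_inter_support, hset, finsum_mem_inter_support,
    finsum_mem_range (Ctx.Valn.env_injective Δ), finsum_eq_sum_of_fintype]

/-! ## Erasure -/

theorem Exp.amp_gphase (T : Ty) (y : Name) (r : ℝ) (e : Exp) (env : Env) (v : T.Val) :
    (Exp.app (gphase T y r) e).amp env T v = Complex.exp (Complex.I * r) * e.amp env T v := by
  rw [Exp.amp_app (T := T) rfl]
  simp only [gphase, Prog.amp, dite_true]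
  -- As the two phases are equal, the projector onto the pattern cancels and its sum over
  -- environments need not be evaluated.
  simp only [← mul_add, add_sub_cancel]
  simp [Matrix.one_apply]

/-- The value of an erased variable can be read off from the result. -/
theorem Erases.exists_value {T : Ty} {x : Name} {es : List Exp} (h : Erases T x es) :
    ∃ g : T.Val → UVal, ∀ e ∈ es, ∀ (env : Env) (v : T.Val), e.amp env T v ≠ 0 →
      env x = some (g v) := by
  induction h with
  | gphase y r _ ih =>
    obtain ⟨g, hg⟩ := ih
    refine ⟨g, fun e he env v hne => ?_⟩
    rw [List.mem_append, List.mem_cons] at he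
    rcases he with he | rfl | he
    · exact hg e (by simp [he]) env v hne
    · rw [Exp.amp_gphase] at hne
      exact hg _ (by simp) env v (right_ne_zero_of_mul hne)
    · exact hg e (by simp [he]) env v hne
  | ctrl e₀ T' m lhs rhs hx _ ih =>
    obtain ⟨g, hg⟩ := ih
    refine ⟨g, fun e he env v hne => ?_⟩
    rw [List.mem_append, List.mem_cons] at he
    rcases he with he | rfl | he
    · exact hg e (by simp [he]) env v hne
    · rw [Exp.amp] at hne
      -- A nonzero result comes from a branch, which belongs to the list before inlining; its
      -- environment agrees with `env` at `x` because the patterns do not bind `x`.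
      obtain ⟨-, j, env', henv, -, -, hr⟩ := exists_branch_ne_zero hne
      rw [← hg (rhs j) (by simp [List.mem_ofFn]) _ v hr,
        Env.override_of_none (Env.eq_none_of_on henv (hx j))]
    · exact hg e (by simp [he]) env v hne
  | var T x n =>
    refine ⟨fun v => ⟨T, v⟩, fun e he env v hne => ?_⟩
    obtain rfl := List.eq_of_mem_replicate he
    by_contra hn
    simp [Exp.amp, hn] at hne
  | pair₀ T₁ ps _ ih =>
    obtain ⟨g, hg⟩ := ih
    refine ⟨fun | .pair v₀ _ => g v₀, fun e he env v hne => ?_⟩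
    obtain ⟨p, hp, rfl⟩ := List.mem_map.mp he
    cases v with
    | pair v₀ v₁ =>
      simp only [Exp.amp, pairAmp] at hne
      exact hg p.1 (List.mem_map_of_mem hp) env v₀ (left_ne_zero_of_mul hne)
  | pair₁ T₀ ps _ ih =>
    obtain ⟨g, hg⟩ := ih
    refine ⟨fun | .pair _ v₁ => g v₁, fun e he env v hne => ?_⟩
    obtain ⟨p, hp, rfl⟩ := List.mem_map.mp he
    cases v with
    | pair v₀ v₁ =>
      simp only [Exp.amp, pairAmp] at hne
      exact hg p.2 (List.mem_map_of_mem hp) env v₁ (right_ne_zero_of_mul hne)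

/-! ## Rank of the syntax -/

mutual
/-- The number of constructors in an expression. -/
def Exp.rank : Exp → ℕ
  | .unit => 0
  | .var _ => 0
  | .pair e₀ e₁ => e₀.rank + e₁.rank + 1
  | .ctrl e _ _ lhs rhs _ => e.rank + ∑ j, ((lhs j).rank + (rhs j).rank) + 1
  | .mtch e _ _ lhs rhs _ => e.rank + ∑ j, ((lhs j).rank + (rhs j).rank) + 1
  | .trycatch e₀ e₁ => e₀.rank + e₁.rank + 1
  | .app f e => f.rank + e.rank + 1
/-- The number of constructors in a program. -/
def Prog.rank : Prog → ℕ
  | .u3 _ _ _ => 0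
  | .left _ _ => 0
  | .right _ _ => 0
  | .lam e _ e' => e.rank + e'.rank + 1
  | .rphase _ e _ _ => e.rank + 1
  | .pmatch _ _ lhs rhs _ => ∑ j, ((lhs j).rank + (rhs j).rank) + 1
end

theorem Exp.rank_branch {n : ℕ} (lhs rhs : Fin n → Exp) (j : Fin n) :
    (lhs j).rank + (rhs j).rank ≤ ∑ j, ((lhs j).rank + (rhs j).rank) :=
  Finset.single_le_sum (f := fun j => (lhs j).rank + (rhs j).rank) (fun _ _ => Nat.zero_le _)
    (Finset.mem_univ j)

/-! ## The properties proved by induction -/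

/-- Expressions whose pure semantics is independent of the typing derivation. -/
def Exp.Tame (e : Exp) : Prop := e.Classical ∨ Nonempty (IsoExp e)

/-- Programs whose pure semantics is independent of the typing derivation. -/
def Prog.Tame (f : Prog) : Prop := f.Classical ∨ Nonempty (IsoProg f)

/-- Soundness of all typing derivations of an expression. -/
structure Exp.Sound (e : Exp) : Prop where
  amp : e.Tame → ∀ {Γ Δ : Ctx} {T : Ty} (h : PureTy Γ Δ e T) (σ : Γ.Valn) (τ : Δ.Valn) (env : Env),
    env.Extends σ τ → ∀ v, h.sem σ v τ = e.amp env T v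
  pinj : e.Classical → ∀ {Γ Δ : Ctx} {T : Ty} (h : PureTy Γ Δ e T) (σ : Γ.Valn), PInj (h.sem σ)
  iso : Nonempty (IsoExp e) → ∀ {Γ Δ : Ctx} {T : Ty} (h : PureTy Γ Δ e T) (σ : Γ.Valn),
    (h.sem σ)ᴴ * h.sem σ = 1
  diag : e.Classical → ∀ {Γ Δ : Ctx} {T : Ty} (h : MixTy Γ Δ e T) (σ : Γ.Valn) (τ : Δ.Valn)
    (env : Env), env.Extends σ τ →
      OneHot (e.amp env T) ∧ h.sem σ (ketbra τ τ) = Matrix.diagonal (e.amp env T)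
  trace : Nonempty (IsoExp e) → ∀ {Γ Δ : Ctx} {T : Ty} (h : MixTy Γ Δ e T) (σ : Γ.Valn)
    (ρ : Matrix Δ.Valn Δ.Valn ℂ), (h.sem σ ρ).trace = ρ.trace

/-- Soundness of all typing derivations of a program. -/
structure Prog.Sound (f : Prog) : Prop where
  amp : f.Tame → ∀ {T T' : Ty} (h : PureProgTy f T T') (v : T.Val) (v' : T'.Val),
    h.sem v' v = f.amp T T' v v'
  pinj : f.Classical → ∀ {T T' : Ty} (h : PureProgTy f T T'), PInj h.sem
  iso : Nonempty (IsoProg f) → ∀ {T T' : Ty} (h : PureProgTy f T T'), h.semᴴ * h.sem = 1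
  diag : f.Classical → ∀ {T T' : Ty} (h : MixProgTy f T T') (v : T.Val),
    OneHot (f.amp T T' v) ∧ h.sem (ketbra v v) = Matrix.diagonal (f.amp T T' v)
  trace : Nonempty (IsoProg f) → ∀ {T T' : Ty} (h : MixProgTy f T T')
    (ρ : Matrix T.Val T.Val ℂ), (h.sem ρ).trace = ρ.trace

-- Matrices of applications, pairs, injections and `u3`.

theorem PureTy.sem_app {Γ Δ : Ctx} {f : Prog} {e : Exp} {T T' : Ty} (hf : PureProgTy f T T')
    (he : PureTy Γ Δ e T) (σ : Γ.Valn) : (PureTy.app hf he).sem σ = hf.sem * he.sem σ := by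
  rw [PureTy.sem]

theorem PureTy.sem_pair {Γ Δ Δ₀ Δ₁ : Ctx} {e₀ e₁ : Exp} {T₀ T₁ : Ty} (hΔ : IsJoin Δ Δ₀ Δ₁)
    (h₀ : PureTy Γ Δ₀ e₀ T₀) (h₁ : PureTy Γ Δ₁ e₁ T₁) (σ : Γ.Valn) (v₀ : T₀.Val) (v₁ : T₁.Val)
    (τ : Δ.Valn) : (PureTy.pair hΔ h₀ h₁).sem σ (.pair v₀ v₁) τ =
      h₀.sem σ v₀ (Valn.res hΔ.left τ) * h₁.sem σ v₁ (Valn.res hΔ.right τ) := by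
  simp only [PureTy.sem]

/-- Inner products of pairs factor. -/
theorem PureTy.conjTranspose_mul_pair {Γ Γ' Δ Δ₀ Δ₁ Δ' Δ₀' Δ₁' : Ctx} {e₀ e₁ e₀' e₁' : Exp}
    {T₀ T₁ : Ty} (hΔ : IsJoin Δ Δ₀ Δ₁) (h₀ : PureTy Γ Δ₀ e₀ T₀) (h₁ : PureTy Γ Δ₁ e₁ T₁)
    (hΔ' : IsJoin Δ' Δ₀' Δ₁') (h₀' : PureTy Γ' Δ₀' e₀' T₀) (h₁' : PureTy Γ' Δ₁' e₁' T₁)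
    (σ : Γ.Valn) (σ' : Γ'.Valn) (τ : Δ.Valn) (τ' : Δ'.Valn) :
    (((PureTy.pair hΔ h₀ h₁).sem σ)ᴴ * (PureTy.pair hΔ' h₀' h₁').sem σ') τ τ' =
      ((h₀.sem σ)ᴴ * h₀'.sem σ') (Valn.res hΔ.left τ) (Valn.res hΔ'.left τ') *
        ((h₁.sem σ)ᴴ * h₁'.sem σ') (Valn.res hΔ.right τ) (Valn.res hΔ'.right τ') := by
  simp only [Matrix.mul_apply, Matrix.conjTranspose_apply, Finset.sum_mul_sum]
  rw [← (Ty.Val.prodEquiv T₀ T₁).symm.sum_comp, Fintype.sum_prod_type]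
  refine Finset.sum_congr rfl fun v₀ _ => Finset.sum_congr rfl fun v₁ _ => ?_
  change star ((PureTy.pair hΔ h₀ h₁).sem σ (.pair v₀ v₁) τ) *
    (PureTy.pair hΔ' h₀' h₁').sem σ' (.pair v₀ v₁) τ' = _
  rw [PureTy.sem_pair, PureTy.sem_pair, star_mul']
  ring

theorem sum_sumVal {T₀ T₁ : Ty} (F : (T₀.sum T₁).Val → ℂ) :
    ∑ v, F v = ∑ v, F (.left v) + ∑ v, F (.right v) := by
  rw [← (Ty.Val.sumEquiv T₀ T₁).symm.sum_comp, Fintype.sum_sum_type]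
  rfl

theorem sum_unitVal (F : Ty.unit.Val → ℂ) : ∑ v, F v = F .unit := by
  rw [← Ty.Val.unitEquiv.symm.sum_comp, Fintype.sum_unique]
  rfl

theorem leftMatrix_iso (T₀ T₁ : Ty) : (leftMatrix T₀ T₁)ᴴ * leftMatrix T₀ T₁ = 1 := by
  ext v w
  simp [Matrix.mul_apply, sum_sumVal, leftMatrix, Matrix.one_apply, eq_comm]

theorem rightMatrix_iso (T₀ T₁ : Ty) : (rightMatrix T₀ T₁)ᴴ * rightMatrix T₀ T₁ = 1 := by
  ext v w
  simp [Matrix.mul_apply, sum_sumVal, rightMatrix, Matrix.one_apply, eq_comm]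

theorem leftMatrix_rightMatrix (T₀ T₁ : Ty) : (leftMatrix T₀ T₁)ᴴ * rightMatrix T₀ T₁ = 0 := by
  ext v w
  simp [Matrix.mul_apply, sum_sumVal, leftMatrix, rightMatrix]

theorem star_exp_mul_exp (r : ℝ) :
    star (Complex.exp (Complex.I * r)) * Complex.exp (Complex.I * r) = 1 := by
  rw [Complex.star_def, ← Complex.exp_conj, ← Complex.exp_add]
  simp

theorem u3Matrix_iso (rθ rφ rl : ℝ) : (u3Matrix rθ rφ rl)ᴴ * u3Matrix rθ rφ rl = 1 := by
  have hs : (Real.sin (rθ / 2) : ℂ) ^ 2 + (Real.cos (rθ / 2) : ℂ) ^ 2 = 1 := by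
    exact_mod_cast Real.sin_sq_add_cos_sq (rθ / 2)
  have hφ := star_exp_mul_exp rφ
  have hl := star_exp_mul_exp rl
  have ha : Complex.exp (Complex.I * (rφ + rl)) =
      Complex.exp (Complex.I * rφ) * Complex.exp (Complex.I * rl) := by
    rw [mul_add, Complex.exp_add]
  have hsr : ∀ r : ℝ, star (r : ℂ) = r := Complex.conj_ofReal
  push_cast at hs
  simp only [Complex.star_def] at hφ hl hsr
  ext v w
  rw [Matrix.mul_apply, sum_sumVal, sum_unitVal, sum_unitVal]
  simp only [Matrix.conjTranspose_apply]
  rcases v with _ | ⟨⟨⟩⟩ | ⟨⟨⟩⟩ <;> rcases w with _ | ⟨⟨⟩⟩ | ⟨⟨⟩⟩ <;>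
    simp only [u3Matrix, ha, star_mul', star_neg, Complex.star_def, hsr, Matrix.one_apply] <;>
    simp
  · linear_combination Complex.sin (rθ / 2) ^ 2 * hφ + hs
  · linear_combination
      Complex.cos (rθ / 2) * Complex.exp (Complex.I * rl) * Complex.sin (rθ / 2) * hφ
  · linear_combination
      (starRingEnd ℂ) (Complex.exp (Complex.I * rl)) * Complex.cos (rθ / 2) *
        Complex.sin (rθ / 2) * hφ
  · linear_combination (Complex.sin (rθ / 2) ^ 2 + Complex.cos (rθ / 2) ^ 2) * hl + hs +
      (starRingEnd ℂ) (Complex.exp (Complex.I * rl)) * Complex.exp (Complex.I * rl) *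
        Complex.cos (rθ / 2) ^ 2 * hφ

/-! ## Orthogonality -/

/-- An isometry applied to both patterns cancels in the inner product, the two injections have
orthogonal ranges, and inner products of pairs factor. The rank bounds stand inside the relation
because the rule `sub` passes to a larger list whose further members can have any rank. -/
theorem Ortho.pairwise {N : ℕ} (ih : ∀ f : Prog, f.rank < N → f.Sound) : ∀ {T : Ty} {es : List Exp},
    Ortho T es → es.Pairwise fun e e' => e.rank ≤ N → e'.rank ≤ N →
      ∀ {Δ Δ' : Ctx} (h : PureTy Ctx.empty Δ e T) (h' : PureTy Ctx.empty Δ' e' T),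
        (h.sem Valn.empty)ᴴ * h'.sem Valn.empty = 0
  | _, _, .void => List.Pairwise.nil
  | _, _, .unit => List.pairwise_singleton _ _
  | _, _, .var _ _ => List.pairwise_singleton _ _
  | _, _, .isoApp (f := f) ho hf hi => by
    refine List.pairwise_map.mpr ((ho.pairwise ih).imp ?_)
    intro e e' hee hr hr' Δ Δ' h h'
    simp only [Exp.rank] at hr hr'
    have hs := ih f (by omega)
    cases h with
    | app k he =>
    cases h' with
    | app k' he' =>
    obtain rfl := hf.src_eq.symm.trans k.src_eq
    obtain rfl := hf.src_eq.symm.trans k'.src_eq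
    -- The two patterns may type `f` by different derivations; both matrices are given by the
    -- amplitudes of `f`.
    have hkk : k'.sem = k.sem := by
      ext v w
      rw [hs.amp (.inr ⟨hi⟩), hs.amp (.inr ⟨hi⟩)]
    rw [PureTy.sem_app, PureTy.sem_app, hkk, Matrix.conjTranspose_mul, Matrix.mul_assoc,
      ← Matrix.mul_assoc (k.semᴴ), hs.iso ⟨hi⟩, Matrix.one_mul, hee (by omega) (by omega)]
  | _, _, .sum h₀ h₁ => by
    refine List.pairwise_append.mpr ⟨List.pairwise_map.mpr ((h₀.pairwise ih).imp ?_),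
      List.pairwise_map.mpr ((h₁.pairwise ih).imp ?_), ?_⟩
    · intro e e' hee hr hr' Δ Δ' h h'
      simp only [Exp.rank] at hr hr'
      cases h with
      | app k he =>
      cases h' with
      | app k' he' =>
      cases k
      cases k'
      rw [PureTy.sem_app, PureTy.sem_app, PureProgTy.sem, Matrix.conjTranspose_mul,
        Matrix.mul_assoc, ← Matrix.mul_assoc (leftMatrix _ _)ᴴ, leftMatrix_iso, Matrix.one_mul,
        hee (by omega) (by omega)]
    · intro e e' hee hr hr' Δ Δ' h h'
      simp only [Exp.rank] at hr hr'
      cases h with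
      | app k he =>
      cases h' with
      | app k' he' =>
      cases k
      cases k'
      rw [PureTy.sem_app, PureTy.sem_app, PureProgTy.sem, Matrix.conjTranspose_mul,
        Matrix.mul_assoc, ← Matrix.mul_assoc (rightMatrix _ _)ᴴ, rightMatrix_iso, Matrix.one_mul,
        hee (by omega) (by omega)]
    · intro e he e' he' hr hr' Δ Δ' h h'
      obtain ⟨e, -, rfl⟩ := List.mem_map.mp he
      obtain ⟨e', -, rfl⟩ := List.mem_map.mp he'
      cases h with
      | app k he =>
      cases h' with
      | app k' he' =>
      cases k
      cases k'
      rw [PureTy.sem_app, PureTy.sem_app, PureProgTy.sem, PureProgTy.sem,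
        Matrix.conjTranspose_mul, Matrix.mul_assoc, ← Matrix.mul_assoc (leftMatrix _ _)ᴴ,
        leftMatrix_rightMatrix, Matrix.zero_mul, Matrix.mul_zero]
  | _, _, .pair L h₀ h₁ _ => by
    refine List.pairwise_flatMap.mpr ⟨fun p hp => ?_, (List.pairwise_map.mp (h₀.pairwise ih)).imp ?_⟩
    · refine List.pairwise_map.mpr (((h₁ p hp).pairwise ih).imp ?_)
      intro e e' hee hr hr' Δ Δ' h h'
      simp only [Exp.rank] at hr hr'
      cases h with
      | pair hΔ a b =>
      cases h' with
      | pair hΔ' a' b' =>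
      ext τ τ'
      rw [PureTy.conjTranspose_mul_pair, hee (by omega) (by omega) b b', Matrix.zero_apply,
        mul_zero, Matrix.zero_apply]
    · intro p q hpq e he e' he' hr hr' Δ Δ' h h'
      obtain ⟨e, -, rfl⟩ := List.mem_map.mp he
      obtain ⟨e', -, rfl⟩ := List.mem_map.mp he'
      simp only [Exp.rank] at hr hr'
      cases h with
      | pair hΔ a b =>
      cases h' with
      | pair hΔ' a' b' =>
      ext τ τ'
      rw [PureTy.conjTranspose_mul_pair, hpq (by omega) (by omega) a a', Matrix.zero_apply,
        zero_mul, Matrix.zero_apply]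
  | _, _, .sub ho hs => (ho.pairwise ih).sublist hs

theorem Ortho.orthogonal {N : ℕ} (ih : ∀ f : Prog, f.rank < N → f.Sound) {T : Ty} {n : ℕ}
    {lhs : Fin n → Exp} (ho : Ortho T (List.ofFn lhs)) (hN : ∀ j, (lhs j).rank ≤ N)
    {Δ : Fin n → Ctx} (hl : ∀ j, PureTy Ctx.empty (Δ j) (lhs j) T) (j k : Fin n) (hjk : j ≠ k) :
    ((hl j).sem Valn.empty)ᴴ * (hl k).sem Valn.empty = 0 := by
  have hp := List.pairwise_ofFn.mp (ho.pairwise ih)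
  rcases lt_or_gt_of_ne hjk with h | h
  · exact hp h (hN j) (hN k) (hl j) (hl k)
  · rw [← Matrix.conjTranspose_conjTranspose (hl k |>.sem Valn.empty), ← Matrix.conjTranspose_mul,
      hp h (hN k) (hN j) (hl k) (hl j), Matrix.conjTranspose_zero]

/-! ## Spanning -/

/-- The isometry rules do not ask for `iso` of the patterns in `λ`, `ctrl`, `match` and `pmatch`; it
is recovered here from the spanning premise. -/
theorem Spanning.iso : ∀ {T : Ty} {es : List Exp}, Spanning T es → ∀ e ∈ es, Nonempty (IsoExp e)
  | _, _, .void, e, he => absurd he List.not_mem_nil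
  | _, _, .unit, e, he => by
    obtain rfl := List.mem_singleton.mp he
    exact ⟨.unit⟩
  | _, _, .var T x, e, he => by
    obtain rfl := List.mem_singleton.mp he
    exact ⟨.var x⟩
  | _, _, .unApp hs _ hi _, e, he => by
    obtain ⟨e, hm, rfl⟩ := List.mem_map.mp he
    exact (hs.iso e hm).map fun h => .app hi h
  | _, _, .sum h₀ h₁, e, he => by
    rcases List.mem_append.mp he with he | he <;> obtain ⟨e, hm, rfl⟩ := List.mem_map.mp he
    · exact (h₀.iso e hm).map fun h => .app (.left _ _) h
    · exact (h₁.iso e hm).map fun h => .app (.right _ _) h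
  | _, _, .pair L h₀ h₁ _, e, he => by
    obtain ⟨p, hp, he⟩ := List.mem_flatMap.mp he
    obtain ⟨e', he', rfl⟩ := List.mem_map.mp he
    obtain ⟨i₀⟩ := h₀.iso p.1 (List.mem_map_of_mem hp)
    obtain ⟨i₁⟩ := (h₁ p hp).iso e' he'
    exact ⟨.pair i₀ i₁⟩

/-- The number of valuations of the context of a pattern. -/
def Exp.patDim : Exp → Ty → ℕ
  | .unit, _ => 1
  | .var _, T => Fintype.card T.Val
  | .pair e₀ e₁, T =>
    match T with
    | .prod T₀ T₁ => e₀.patDim T₀ * e₁.patDim T₁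
    | _ => 0
  | .app f e, _ => e.patDim f.src
  | _, _ => 0

theorem card_prodVal (T₀ T₁ : Ty) :
    Fintype.card (T₀.prod T₁).Val = Fintype.card T₀.Val * Fintype.card T₁.Val := by
  rw [Fintype.card_congr (Ty.Val.prodEquiv T₀ T₁), Fintype.card_prod]

theorem card_sumVal (T₀ T₁ : Ty) :
    Fintype.card (T₀.sum T₁).Val = Fintype.card T₀.Val + Fintype.card T₁.Val := by
  rw [Fintype.card_congr (Ty.Val.sumEquiv T₀ T₁), Fintype.card_sum]

/-- Sums add dimensions and pairs multiply them. In `unApp` the count survives only because source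
and target of `f` have equal dimension. -/
theorem Spanning.sum_patDim : ∀ {T : Ty} {es : List Exp}, Spanning T es →
    (es.map fun e => e.patDim T).sum = Fintype.card T.Val
  | _, _, .void => by
    rw [Fintype.card_congr Ty.Val.voidEquiv]; rfl
  | _, _, .unit => by
    rw [Fintype.card_congr Ty.Val.unitEquiv]; simp [Exp.patDim]
  | _, _, .var T x => by simp [Exp.patDim]
  | _, _, .unApp hs hf _ hd => by
    rw [finrank_euclideanSpace, finrank_euclideanSpace] at hd
    rw [← hd, ← hs.sum_patDim, List.map_map]
    refine congrArg List.sum (List.map_congr_left fun e _ => ?_)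
    simp [Exp.patDim, hf.src_eq]
  | _, _, .sum h₀ h₁ => by
    rw [card_sumVal, ← h₀.sum_patDim, ← h₁.sum_patDim, List.map_append, List.sum_append,
      List.map_map, List.map_map]
    simp [Function.comp_def, Exp.patDim, Prog.src]
  | .prod T₀ T₁, _, .pair L h₀ h₁ _ => by
    have h : (L.map fun p => ((p.2.map (Exp.pair p.1)).map
        fun e => e.patDim (T₀.prod T₁)).sum) =
        L.map fun p => p.1.patDim T₀ * Fintype.card T₁.Val := by
      refine List.map_congr_left fun p hp => ?_
      rw [← (h₁ p hp).sum_patDim, List.map_map, ← List.sum_map_mul_left]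
      simp [Function.comp_def, Exp.patDim]
    rw [List.map_flatMap, List.flatMap_def, List.sum_flatten, List.map_map, Function.comp_def, h, List.sum_map_mul_right, card_prodVal,
      ← h₀.sum_patDim, List.map_map]
    rfl

theorem Ctx.card_valn (Δ : Ctx) : Fintype.card Δ.Valn = ∏ p ∈ Δ.binds, Fintype.card p.2.Val := by
  rw [← Finset.prod_coe_sort Δ.binds fun p => Fintype.card p.2.Val]
  exact Fintype.card_pi

theorem card_valn_single (x : Name) (T : Ty) :
    Fintype.card (Ctx.single x T).Valn = Fintype.card T.Val := by
  rw [Ctx.card_valn]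
  exact Finset.prod_singleton _ _

theorem IsSplit.card_valn {Δ Δ₀ Δ₁ : Ctx} (h : IsSplit Δ Δ₀ Δ₁) :
    Fintype.card Δ.Valn = Fintype.card Δ₀.Valn * Fintype.card Δ₁.Valn := by
  rw [Ctx.card_valn, Ctx.card_valn, Ctx.card_valn, h.eq, Finset.prod_union h.disj]

/-- The two claims are proved together: for a pair, the bound on the domains and the disjointness of
free variables make the two contexts disjoint, and then the numbers of valuations multiply. -/
theorem Spanning.card_valn : ∀ {T : Ty} {es : List Exp}, Spanning T es → ∀ e ∈ es, ∀ {Δ : Ctx},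
    PureTy Ctx.empty Δ e T → Δ.dom ⊆ e.fv ∧ Fintype.card Δ.Valn = e.patDim T
  | _, _, .void, e, he, _, _ => absurd he List.not_mem_nil
  | _, _, .unit, e, he, _, h => by
    obtain rfl := List.mem_singleton.mp he
    cases h
    exact ⟨by simp [Ctx.dom_empty], rfl⟩
  | _, _, .var T x, e, he, _, h => by
    obtain rfl := List.mem_singleton.mp he
    cases h with
    | cvar _ _ _ hx => exact absurd hx Ctx.notMem_empty
    | qvar => exact ⟨by simp [Ctx.dom, Ctx.single, Exp.fv], card_valn_single x T⟩
  | _, _, .unApp ho hf _ _, e, he, _, h => by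
    obtain ⟨e, hm, rfl⟩ := List.mem_map.mp he
    cases h with
    | app hf' he' =>
      obtain rfl := hf.src_eq.symm.trans hf'.src_eq
      simpa only [Exp.fv, Exp.patDim, hf.src_eq] using ho.card_valn e hm he'
  | _, _, .sum h₀ h₁, e, he, _, h => by
    rcases List.mem_append.mp he with he | he
    all_goals
      obtain ⟨e, hm, rfl⟩ := List.mem_map.mp he
      cases h with
      | app hf' he' =>
        cases hf'
        simp only [Exp.fv, Exp.patDim, Prog.src]
        first | exact h₀.card_valn e hm he' | exact h₁.card_valn e hm he'
  | _, _, .pair L h₀ h₁ hfv, e, he, _, h => by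
    obtain ⟨p, hp, he⟩ := List.mem_flatMap.mp he
    obtain ⟨e', he', rfl⟩ := List.mem_map.mp he
    cases h with
    | pair hΔ k₀ k₁ =>
      obtain ⟨i₀, c₀⟩ := h₀.card_valn p.1 (List.mem_map_of_mem hp) k₀
      obtain ⟨i₁, c₁⟩ := (h₁ p hp).card_valn e' he' k₁
      constructor
      · intro x hx
        rw [Exp.fv, Finset.mem_union]
        exact (hΔ.mem_dom.mp hx).imp (@i₀ x) (@i₁ x)
      · have hs : IsSplit _ _ _ := ⟨hΔ.eq, Finset.disjoint_left.mpr fun q hq₀ hq₁ =>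
          Finset.disjoint_left.mp (hfv p hp e' he') (i₀ (Ctx.mem_dom_of_mem hq₀))
            (i₁ (Ctx.mem_dom_of_mem hq₁))⟩
        rw [hs.card_valn, c₀, c₁, Exp.patDim]

/-- Orthonormal spanning patterns resolve the identity. -/
theorem Spanning.sum_mul_conjTranspose {T : Ty} {n : ℕ} {lhs : Fin n → Exp}
    (hs : Spanning T (List.ofFn lhs)) {Δ : Fin n → Ctx}
    (hl : ∀ j, PureTy Ctx.empty (Δ j) (lhs j) T)
    (hi : ∀ j, ((hl j).sem Valn.empty)ᴴ * (hl j).sem Valn.empty = 1)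
    (ho : ∀ j k, j ≠ k → ((hl j).sem Valn.empty)ᴴ * (hl k).sem Valn.empty = 0) :
    ∑ j, (hl j).sem Valn.empty * ((hl j).sem Valn.empty)ᴴ = 1 := by
  -- All pattern matrices side by side. Orthonormality says `Wᴴ * W = 1`; the dimension count makes
  -- `W` square, so that also `W * Wᴴ = 1`.
  let W : Matrix T.Val ((j : Fin n) × (Δ j).Valn) ℂ := Matrix.of fun v s =>
    (hl s.1).sem Valn.empty v s.2
  have hW : Wᴴ * W = 1 := by
    ext ⟨j, a⟩ ⟨k, b⟩
    change (((hl j).sem Valn.empty)ᴴ * (hl k).sem Valn.empty) a b = _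
    by_cases hjk : j = k
    · subst hjk
      rw [hi, Matrix.one_apply, Matrix.one_apply]
      simp
    · rw [ho j k hjk, Matrix.one_apply_ne (by simp [hjk]), Matrix.zero_apply]
  have hcard : Fintype.card ((j : Fin n) × (Δ j).Valn) = Fintype.card T.Val := by
    rw [Fintype.card_sigma, ← hs.sum_patDim, List.map_ofFn, List.sum_ofFn]
    exact Finset.sum_congr rfl fun j _ => (hs.card_valn _ (List.mem_ofFn.mpr ⟨j, rfl⟩) (hl j)).2
  have hW' : W * Wᴴ = 1 := (Matrix.mul_eq_one_comm_of_card_eq _ _ _ hcard).mp hW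
  rw [← hW']
  ext v w
  simp [Matrix.sum_apply, Matrix.mul_apply, Fintype.sum_sigma, W]

theorem Spanning.mul_conjTranspose {T : Ty} {e : Exp} (hs : Spanning T [e]) {Δ : Ctx}
    (h : PureTy Ctx.empty Δ e T) (hi : (h.sem Valn.empty)ᴴ * h.sem Valn.empty = 1) :
    h.sem Valn.empty * (h.sem Valn.empty)ᴴ = 1 := by
  have := Spanning.sum_mul_conjTranspose (n := 1) (lhs := fun _ => e) (by simpa using hs)
    (fun _ => h) (fun _ => hi) fun j k hjk => absurd (Subsingleton.elim j k) hjk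
  simpa using this

/-! ## Restrictions of valuations -/

theorem Valn.eq_of_res {Δ Δ₀ Δ₁ : Ctx} (heq : Δ.binds = Δ₀.binds ∪ Δ₁.binds)
    (h₀ : Δ₀.binds ⊆ Δ.binds) (h₁ : Δ₁.binds ⊆ Δ.binds) {τ τ' : Δ.Valn}
    (e₀ : Valn.res h₀ τ = Valn.res h₀ τ') (e₁ : Valn.res h₁ τ = Valn.res h₁ τ') : τ = τ' := by
  funext ⟨p, hp⟩
  rcases Finset.mem_union.mp (heq ▸ hp) with h | h
  · exact congrFun e₀ ⟨p, h⟩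
  · exact congrFun e₁ ⟨p, h⟩

/-- The two restrictions determine the valuation even if the parts overlap, so variables shared by
two subexpressions do no harm. -/
theorem Valn.ite_res_mul {Δ Δ₀ Δ₁ : Ctx} (heq : Δ.binds = Δ₀.binds ∪ Δ₁.binds)
    (h₀ : Δ₀.binds ⊆ Δ.binds) (h₁ : Δ₁.binds ⊆ Δ.binds) (τ τ' : Δ.Valn) :
    (if Valn.res h₀ τ = Valn.res h₀ τ' then (1 : ℂ) else 0) *
      (if Valn.res h₁ τ = Valn.res h₁ τ' then 1 else 0) = if τ = τ' then 1 else 0 := by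
  by_cases h : τ = τ'
  · subst h; simp
  · by_cases e₀ : Valn.res h₀ τ = Valn.res h₀ τ'
    · have e₁ : Valn.res h₁ τ ≠ Valn.res h₁ τ' := fun e₁ => h (Valn.eq_of_res heq h₀ h₁ e₀ e₁)
      simp [h, e₁]
    · simp [h, e₀]

theorem sum_single_mul {ι : Type} [Fintype ι] [DecidableEq ι] (i : ι) (F : ι → ℂ) :
    ∑ k, (Pi.single i 1 : ι → ℂ) k * F k = F i := by
  simp [Pi.single_apply]

/-! ## Subterms of tame terms -/

theorem Exp.Tame.pair {e₀ e₁ : Exp} (h : (Exp.pair e₀ e₁).Tame) : e₀.Tame ∧ e₁.Tame := by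
  rcases h with h | h
  · rw [Exp.Classical] at h; exact ⟨.inl h.1, .inl h.2⟩
  · obtain ⟨h⟩ := h
    cases h with | pair h₀ h₁ => exact ⟨.inr ⟨h₀⟩, .inr ⟨h₁⟩⟩

theorem Exp.Tame.app {f : Prog} {e : Exp} (h : (Exp.app f e).Tame) : f.Tame ∧ e.Tame := by
  rcases h with h | h
  · rw [Exp.Classical] at h; exact ⟨.inl h.1, .inl h.2⟩
  · obtain ⟨h⟩ := h
    cases h with | app h₀ h₁ => exact ⟨.inr ⟨h₀⟩, .inr ⟨h₁⟩⟩

/-- Either reason for tameness makes the scrutinee classical, which allows its diagonal weights to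
be replaced by amplitudes. -/
theorem Exp.Tame.ctrl {e : Exp} {T T' : Ty} {n : ℕ} {lhs rhs : Fin n → Exp}
    (h : (Exp.ctrl e T n lhs rhs T').Tame) : e.Classical ∧ ∀ j, (rhs j).Tame := by
  rcases h with h | h
  · rw [Exp.Classical] at h; exact ⟨h.1, fun j => .inl (h.2.2 j)⟩
  · obtain ⟨h⟩ := h
    cases h with | ctrl hc _ _ hr => exact ⟨hc, fun j => .inr ⟨hr j⟩⟩

theorem Prog.Tame.lam {e e' : Exp} {T : Ty} (h : (Prog.lam e T e').Tame) : e.Tame ∧ e'.Tame := by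
  rcases h with h | h
  · rw [Prog.Classical] at h; exact ⟨.inl h.1, .inl h.2⟩
  · obtain ⟨h⟩ := h
    cases h with | lam hs hi => exact ⟨.inr (hs.iso e (by simp)), .inr ⟨hi⟩⟩

theorem Prog.Tame.rphase {e : Exp} {T : Ty} {r r' : ℝ} (h : (Prog.rphase T e r r').Tame) :
    e.Tame := by
  rcases h with h | h
  · rw [Prog.Classical] at h; exact h.elim
  · obtain ⟨h⟩ := h
    cases h with | rphase _ _ _ hi => exact .inr ⟨hi⟩

theorem Spanning.iso_ofFn {T : Ty} {n : ℕ} {lhs : Fin n → Exp} (h : Spanning T (List.ofFn lhs))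
    (j : Fin n) : Nonempty (IsoExp (lhs j)) :=
  h.iso _ (List.mem_ofFn.mpr ⟨j, rfl⟩)

theorem Prog.Tame.pmatch {T T' : Ty} {n : ℕ} {lhs rhs : Fin n → Exp}
    (h : (Prog.pmatch T n lhs rhs T').Tame) (j : Fin n) : (lhs j).Tame ∧ (rhs j).Tame := by
  rcases h with h | h
  · rw [Prog.Classical] at h; exact ⟨.inl (h.1 j), .inl (h.2 j)⟩
  · obtain ⟨h⟩ := h
    cases h with | pmatch hs hi => exact ⟨.inr (hs.iso_ofFn j), .inr ⟨hi j⟩⟩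

/-! ## Sums over branches -/

section Branches

variable {T : Ty} {n : ℕ} {lhs : Fin n → Exp} {Γl : Fin n → Ctx}

theorem sum_branch_amp (hl : ∀ j, PureTy Ctx.empty (Γl j) (lhs j) T)
    (hs : ∀ j, (lhs j).Sound) (hc : ∀ j, (lhs j).Classical) (v : T.Val) (G : Fin n → Env → ℂ) :
    ∑ j, ∑ᶠ env' ∈ Env.on (lhs j).fv, star ((lhs j).amp env' T v) * G j env' =
      ∑ s : (j : Fin n) × (Γl j).Valn,
        star ((hl s.1).sem Valn.empty v s.2) * G s.1 s.2.env := by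
  rw [Fintype.sum_sigma]
  refine Finset.sum_congr rfl fun j _ => ?_
  rw [(hl j).finsum_env]
  refine Finset.sum_congr rfl fun τ _ => ?_
  rw [(hs j).amp (.inl (hc j)) (hl j) _ _ _ (Env.extends_env τ)]

/-- A value matches at most one pattern with at most one binding: each classical pattern is a
partial injection, and two orthogonal ones cannot share a value. -/
theorem branch_oneHot (hl : ∀ j, PureTy Ctx.empty (Γl j) (lhs j) T)
    (hs : ∀ j, (lhs j).Sound) (hc : ∀ j, (lhs j).Classical) {N : ℕ}
    (ih : ∀ f : Prog, f.rank < N → f.Sound) (ho : Ortho T (List.ofFn lhs))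
    (hN : ∀ j, (lhs j).rank ≤ N) (v : T.Val) :
    OneHot fun s : (j : Fin n) × (Γl j).Valn => star ((hl s.1).sem Valn.empty v s.2) :=
  (oneHot_sigma (fun j => (hs j).pinj (hc j) (hl j) Valn.empty)
    (fun j k hjk => ho.orthogonal ih hN hl j k hjk) v).star

/-- The resolution of the identity gives row `v` norm one; being one-hot, it contains exactly one
match. -/
theorem branch_sum_eq_one (hl : ∀ j, PureTy Ctx.empty (Γl j) (lhs j) T)
    (hs : ∀ j, (lhs j).Sound) (hc : ∀ j, (lhs j).Classical) {N : ℕ}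
    (ih : ∀ f : Prog, f.rank < N → f.Sound) (ho : Ortho T (List.ofFn lhs))
    (hN : ∀ j, (lhs j).rank ≤ N) (hsp : Spanning T (List.ofFn lhs)) (v : T.Val) :
    ∑ s : (j : Fin n) × (Γl j).Valn, star ((hl s.1).sem Valn.empty v s.2) = 1 := by
  refine (branch_oneHot hl hs hc ih ho hN v).sum_eq_one ?_
  have h := congrFun (congrFun (hsp.sum_mul_conjTranspose hl
    (fun j => (hs j).iso (hsp.iso_ofFn j) (hl j) Valn.empty)
    (fun j k hjk => ho.orthogonal ih hN hl j k hjk)) v) v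
  rw [Matrix.one_apply_eq] at h
  rw [← h]
  simp [Matrix.sum_apply, Matrix.mul_apply, Fintype.sum_sigma, mul_comm]

end Branches

theorem PureTy.sem_ctrl {Γ Δ Δ₀ Δ₁ : Ctx} {e : Exp} {T T' : Ty} {n : ℕ} {lhs rhs : Fin n → Exp}
    (Γl Γr : Fin n → Ctx) (hΔ : IsSplit Δ Δ₀ Δ₁) (he : MixTy Γ Δ₀ e T)
    (ho : Ortho T (List.ofFn lhs)) (hl : ∀ j, PureTy Ctx.empty (Γl j) (lhs j) T)
    (hc : ∀ j, (lhs j).Classical) (her : ∀ x ∈ Δ₀.dom, Erases T' x (List.ofFn rhs))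
    (hΓ : ∀ j, IsSplit (Γr j) Γ (Γl j)) (hr : ∀ j, PureTy (Γr j) Δ (rhs j) T') (σ : Γ.Valn)
    (v' : T'.Val) (τ : Δ.Valn) :
    (PureTy.ctrl Γl Γr hΔ he ho hl hc her hΓ hr).sem σ v' τ =
      ∑ v, he.sem σ (ketbra (Valn.res hΔ.left τ) (Valn.res hΔ.left τ)) v v *
        ∑ s : (j : Fin n) × (Γl j).Valn, star ((hl s.1).sem Valn.empty v s.2) *
          (hr s.1).sem (Valn.append (hΓ s.1) σ s.2) v' τ := by
  simp only [PureTy.sem, Fintype.sum_sigma, Matrix.conjTranspose_apply]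

theorem MixTy.sem_mtch {Γ Δ Δ₀ Δ₁ : Ctx} {e : Exp} {T T' : Ty} {n : ℕ} {lhs rhs : Fin n → Exp}
    (Γl Γr : Fin n → Ctx) (hΔ : IsJoin Δ Δ₀ Δ₁) (he : MixTy Γ Δ₀ e T)
    (ho : Ortho T (List.ofFn lhs)) (hl : ∀ j, PureTy Ctx.empty (Γl j) (lhs j) T)
    (hc : ∀ j, (lhs j).Classical) (hΓ : ∀ j, IsSplit (Γr j) Γ (Γl j))
    (hr : ∀ j, MixTy (Γr j) Δ₁ (rhs j) T') (σ : Γ.Valn) :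
    (MixTy.mtch Γl Γr hΔ he ho hl hc hΓ hr).sem σ = linExt fun τ τ' =>
      ∑ v, he.sem σ (ketbra (Valn.res hΔ.left τ) (Valn.res hΔ.left τ')) v v •
        ∑ s : (j : Fin n) × (Γl j).Valn, star ((hl s.1).sem Valn.empty v s.2) •
          (hr s.1).sem (Valn.append (hΓ s.1) σ s.2)
            (ketbra (Valn.res hΔ.right τ) (Valn.res hΔ.right τ')) := by
  simp only [MixTy.sem, Fintype.sum_sigma, Matrix.conjTranspose_apply]

/-! ## Pure expressions -/

/-- The induction hypothesis: soundness of all terms of smaller rank. -/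
structure SoundBelow (N : ℕ) : Prop where
  exp : ∀ e : Exp, e.rank < N → e.Sound
  prog : ∀ f : Prog, f.rank < N → f.Sound

/-- Only `ctrl` contains a mixed derivation. Its scrutinee is classical by tameness, so the weights
are the amplitudes of the scrutinee, whatever its derivation. -/
theorem PureTy.sem_eq_amp {e : Exp} (ih : SoundBelow e.rank) (ht : e.Tame) {Γ Δ : Ctx} {T : Ty}
    (h : PureTy Γ Δ e T) (σ : Γ.Valn) (τ : Δ.Valn) (env : Env) (hE : env.Extends σ τ)
    (v : T.Val) : h.sem σ v τ = e.amp env T v := by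
  cases h with
  | unit => simp [PureTy.sem, Exp.amp]
  | cvar _ x _ hx => simp [PureTy.sem, Exp.amp, hE.cl x T hx, eq_comm]
  | qvar _ x _ hx =>
    simp [PureTy.sem, Exp.amp, hE.qu x T (Ctx.mem_single x T) hx, eq_comm]
  | pair hΔ h₀ h₁ =>
    cases v with
    | pair v₀ v₁ =>
      rw [PureTy.sem_pair, Exp.amp, pairAmp,
        (ih.exp _ (by simp only [Exp.rank]; omega)).amp ht.pair.1 h₀ _ _ _ (hE.res hΔ.left),
        (ih.exp _ (by simp only [Exp.rank]; omega)).amp ht.pair.2 h₁ _ _ _ (hE.res hΔ.right)]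
  | app hf he =>
    rw [PureTy.sem_app, Matrix.mul_apply, Exp.amp_app hf.src_eq]
    refine Finset.sum_congr rfl fun w _ => ?_
    rw [(ih.exp _ (by simp only [Exp.rank]; omega)).amp ht.app.2 he _ _ _ hE,
      (ih.prog _ (by simp only [Exp.rank]; omega)).amp ht.app.1 hf]
  | @ctrl _ _ _ _ e T _ n lhs rhs Γl Γr hΔ he ho hl hc her hΓ hr =>
    have hrk := Exp.rank_branch lhs rhs
    have hsl : ∀ j, (lhs j).Sound := fun j =>
      ih.exp _ (by simp only [Exp.rank]; have := hrk j; omega)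
    have hsr : ∀ j, (rhs j).Sound := fun j =>
      ih.exp _ (by simp only [Exp.rank]; have := hrk j; omega)
    have hse : e.Sound := ih.exp _ (by simp only [Exp.rank]; omega)
    rw [PureTy.sem_ctrl, Exp.amp]
    refine Finset.sum_congr rfl fun w _ => ?_
    rw [sum_branch_amp hl hsl hc w fun j env' => (rhs j).amp (env'.override env) _ v,
      (hse.diag ht.ctrl.1 he σ _ env (hE.res hΔ.left)).2, Matrix.diagonal_apply_eq]
    congr 1
    refine Finset.sum_congr rfl fun s _ => ?_
    rw [(hsr s.1).amp (ht.ctrl.2 s.1) (hr s.1) _ _ _ (hE.append (hΓ s.1) s.2)]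

section Ctrl

variable {Γ Δ Δ₀ Δ₁ : Ctx} {e : Exp} {T T' : Ty} {n : ℕ} {lhs rhs : Fin n → Exp}
  (Γl Γr : Fin n → Ctx) (hΔ : IsSplit Δ Δ₀ Δ₁) (he : MixTy Γ Δ₀ e T)
  (ho : Ortho T (List.ofFn lhs)) (hl : ∀ j, PureTy Ctx.empty (Γl j) (lhs j) T)
  (hc : ∀ j, (lhs j).Classical) (her : ∀ x ∈ Δ₀.dom, Erases T' x (List.ofFn rhs))
  (hΓ : ∀ j, IsSplit (Γr j) Γ (Γl j)) (hr : ∀ j, PureTy (Γr j) Δ (rhs j) T') (σ : Γ.Valn)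

/-- The result of any branch determines the values of the erased variables. -/
theorem PureTy.res_eq_of_erases {Γ' Γ'' : Ctx} (hsr : ∀ j, (rhs j).Sound)
    (htr : ∀ j, (rhs j).Tame) (her : ∀ x ∈ Δ₀.dom, Erases T' x (List.ofFn rhs))
    (hs : Δ₀.binds ⊆ Δ.binds) {j k : Fin n} (hj : PureTy Γ' Δ (rhs j) T')
    (hk : PureTy Γ'' Δ (rhs k) T') {σ' : Γ'.Valn} {σ'' : Γ''.Valn} {v : T'.Val} {τ τ' : Δ.Valn}
    (h : hj.sem σ' v τ ≠ 0) (h' : hk.sem σ'' v τ' ≠ 0) : Valn.res hs τ = Valn.res hs τ' := by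
  funext ⟨⟨x, X⟩, hX⟩
  obtain ⟨g, hg⟩ := (her x (Ctx.mem_dom_of_mem hX)).exists_value
  -- The function `g` depends only on the list of branches, so a nonzero entry in row `v` forces the
  -- same value of `x` for every branch, classical valuation and derivation.
  have key : ∀ {Γ : Ctx} (i : Fin n) (hi : PureTy Γ Δ (rhs i) T') (σ : Γ.Valn) (τ : Δ.Valn),
      hi.sem σ v τ ≠ 0 → some (⟨X, τ ⟨(x, X), hs hX⟩⟩ : UVal) = some (g v) := by
    intro Γ i hi σ τ hne
    have hE := Env.extends_override σ τ
    rw [(hsr i).amp (htr i) hi _ _ _ hE] at hne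
    have hx := (hi.mem_of_amp_ne_zero _ v hne x X (hs hX)).2.1
    rw [← hE.qu x X (hs hX) hx]
    exact hg _ (List.mem_ofFn.mpr ⟨i, rfl⟩) _ v hne
  have := (key j hj σ' τ h).trans (key k hk σ'' τ' h').symm
  exact eq_of_heq (Sigma.mk.inj (Option.some.inj this)).2

/-- On a basis vector, `ctrl` vanishes or acts as one of its branches, which is determined by the
part of the basis vector that is consumed by the scrutinee. -/
theorem PureTy.sem_ctrl_branch {N : ℕ} (ih : ∀ f : Prog, f.rank < N → f.Sound)
    (hN : ∀ j, (lhs j).rank ≤ N) (hse : e.Sound) (hce : e.Classical) (hsl : ∀ j, (lhs j).Sound)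
    (τ₀ : Δ₀.Valn) :
    (∀ v' τ, Valn.res hΔ.left τ = τ₀ →
      (PureTy.ctrl Γl Γr hΔ he ho hl hc her hΓ hr).sem σ v' τ = 0) ∨
    ∃ s : (j : Fin n) × (Γl j).Valn, ∀ v' τ, Valn.res hΔ.left τ = τ₀ →
      (PureTy.ctrl Γl Γr hΔ he ho hl hc her hΓ hr).sem σ v' τ =
        (hr s.1).sem (Valn.append (hΓ s.1) σ s.2) v' τ := by
  obtain ⟨h1, hd⟩ := hse.diag hce he σ τ₀ _ (Env.extends_override σ τ₀)
  rcases h1.eq_zero_or_single with h0 | ⟨v, hv⟩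
  · refine .inl fun v' τ hτ => ?_
    simp [PureTy.sem_ctrl, hτ, hd, h0]
  · have hb := branch_oneHot hl hsl hc ih ho hN v
    classical
    rcases hb.eq_zero_or_single with h0 | ⟨s, hs⟩
    · refine .inl fun v' τ hτ => ?_
      have h0' : ∀ s : (j : Fin n) × (Γl j).Valn, star ((hl s.1).sem Valn.empty v s.2) = 0 :=
        fun s => congrFun h0 s
      rw [PureTy.sem_ctrl]
      simp only [hτ, hd, hv, Matrix.diagonal_apply_eq, sum_single_mul, h0', zero_mul,
        Finset.sum_const_zero]
    · refine .inr ⟨s, fun v' τ hτ => ?_⟩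
      have hs' : ∀ s' : (j : Fin n) × (Γl j).Valn,
          star ((hl s'.1).sem Valn.empty v s'.2) = (Pi.single s 1 : _ → ℂ) s' :=
        fun s' => congrFun hs s'
      rw [PureTy.sem_ctrl]
      simp only [hτ, hd, hv, Matrix.diagonal_apply_eq, sum_single_mul, hs']

/-- If moreover the scrutinee is an isometry and the patterns are spanning, some branch is taken. -/
theorem PureTy.sem_ctrl_branch_of_iso {N : ℕ} (ih : ∀ f : Prog, f.rank < N → f.Sound)
    (hN : ∀ j, (lhs j).rank ≤ N) (hse : e.Sound) (hce : e.Classical) (hsl : ∀ j, (lhs j).Sound)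
    (hie : Nonempty (IsoExp e)) (hsp : Spanning T (List.ofFn lhs)) (τ₀ : Δ₀.Valn) :
    ∃ s : (j : Fin n) × (Γl j).Valn, ∀ v' τ, Valn.res hΔ.left τ = τ₀ →
      (PureTy.ctrl Γl Γr hΔ he ho hl hc her hΓ hr).sem σ v' τ =
        (hr s.1).sem (Valn.append (hΓ s.1) σ s.2) v' τ := by
  classical
  obtain ⟨h1, hd⟩ := hse.diag hce he σ τ₀ _ (Env.extends_override σ τ₀)
  -- Trace one rules out that the scrutinee gives zero.
  have ht := hse.trace hie he σ (ketbra τ₀ τ₀)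
  rw [hd, Matrix.trace_diagonal, trace_ketbra, if_pos rfl] at ht
  obtain ⟨v, hv⟩ := h1.exists_single ht
  obtain ⟨s, hs⟩ := (branch_oneHot hl hsl hc ih ho hN v).exists_single
    (branch_sum_eq_one hl hsl hc ih ho hN hsp v)
  refine ⟨s, fun v' τ hτ => ?_⟩
  have hs' : ∀ s' : (j : Fin n) × (Γl j).Valn,
      star ((hl s'.1).sem Valn.empty v s'.2) = (Pi.single s 1 : _ → ℂ) s' :=
    fun s' => congrFun hs s'
  rw [PureTy.sem_ctrl]
  simp only [hτ, hd, hv, Matrix.diagonal_apply_eq, sum_single_mul, hs']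

end Ctrl

theorem PureTy.pinj_pair {Γ Δ Δ₀ Δ₁ : Ctx} {e₀ e₁ : Exp} {T₀ T₁ : Ty} (hΔ : IsJoin Δ Δ₀ Δ₁)
    (h₀ : PureTy Γ Δ₀ e₀ T₀) (h₁ : PureTy Γ Δ₁ e₁ T₁) (σ : Γ.Valn) (i₀ : PInj (h₀.sem σ))
    (i₁ : PInj (h₁.sem σ)) : PInj ((PureTy.pair hΔ h₀ h₁).sem σ) := by
  refine PInj.of_entries ?_ ?_ ?_
  · rintro ⟨⟩ τ
    rename_i v₀ v₁
    rw [PureTy.sem_pair]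
    rcases (i₀.row v₀).val (Valn.res hΔ.left τ) with h | h <;>
      rcases (i₁.row v₁).val (Valn.res hΔ.right τ) with h' | h' <;> simp [h, h']
  · rintro ⟨⟩ ⟨⟩ τ h h'
    rw [PureTy.sem_pair] at h h'
    rw [(i₀.col _).uniq _ _ (left_ne_zero_of_mul h) (left_ne_zero_of_mul h'),
      (i₁.col _).uniq _ _ (right_ne_zero_of_mul h) (right_ne_zero_of_mul h')]
  · rintro ⟨⟩ τ τ' h h'
    rw [PureTy.sem_pair] at h h'
    exact Valn.eq_of_res hΔ.eq hΔ.left hΔ.right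
      ((i₀.row _).uniq _ _ (left_ne_zero_of_mul h) (left_ne_zero_of_mul h'))
      ((i₁.row _).uniq _ _ (right_ne_zero_of_mul h) (right_ne_zero_of_mul h'))

theorem Ctx.valn_single_ext {x : Name} {T : Ty} {τ τ' : (Ctx.single x T).Valn}
    (h : τ ⟨(x, T), Ctx.mem_single x T⟩ = τ' ⟨(x, T), Ctx.mem_single x T⟩) : τ = τ' := by
  funext ⟨p, hp⟩
  obtain rfl := Finset.mem_singleton.mp hp
  exact h

theorem Ctx.valn_empty_ext (τ τ' : Ctx.empty.Valn) : τ = τ' :=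
  funext fun p => absurd p.2 Ctx.notMem_empty

theorem PureTy.pinj_of_below {e : Exp} (ih : SoundBelow e.rank) (hcl : e.Classical) {Γ Δ : Ctx}
    {T : Ty} (h : PureTy Γ Δ e T) (σ : Γ.Valn) : PInj (h.sem σ) := by
  cases h with
  | unit =>
    refine PInj.of_entries (fun _ _ => ?_) ?_ fun _ _ _ _ _ => Ctx.valn_empty_ext _ _
    · simp [PureTy.sem]
    · rintro ⟨⟩ ⟨⟩ _ _ _; rfl
  | cvar _ x _ hx =>
    refine PInj.of_entries (fun v _ => ?_) (fun v w _ h h' => ?_)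
      fun _ _ _ _ _ => Ctx.valn_empty_ext _ _
    · simp only [PureTy.sem]; split_ifs <;> simp
    · simp only [PureTy.sem, ne_eq, ite_eq_right_iff, one_ne_zero, imp_false, not_not] at h h'
      rw [h, h']
  | qvar _ x _ hx =>
    refine PInj.of_entries (fun v _ => ?_) (fun v w _ h h' => ?_) fun v _ _ h h' => ?_
    · simp only [PureTy.sem]; split_ifs <;> simp
    · simp only [PureTy.sem, ne_eq, ite_eq_right_iff, one_ne_zero, imp_false, not_not] at h h'
      rw [h, h']
    · simp only [PureTy.sem, ne_eq, ite_eq_right_iff, one_ne_zero, imp_false, not_not] at h h'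
      exact Ctx.valn_single_ext (h.symm.trans h')
  | pair hΔ h₀ h₁ =>
    rw [Exp.Classical] at hcl
    exact PureTy.pinj_pair hΔ h₀ h₁ σ
      ((ih.exp _ (by simp only [Exp.rank]; omega)).pinj hcl.1 h₀ σ)
      ((ih.exp _ (by simp only [Exp.rank]; omega)).pinj hcl.2 h₁ σ)
  | app hf he =>
    rw [Exp.Classical] at hcl
    rw [PureTy.sem_app]
    exact ((ih.prog _ (by simp only [Exp.rank]; omega)).pinj hcl.1 hf).mul
      ((ih.exp _ (by simp only [Exp.rank]; omega)).pinj hcl.2 he σ)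
  | @ctrl _ _ _ _ e T _ n lhs rhs Γl Γr hΔ he ho hl hc her hΓ hr =>
    have hrk := Exp.rank_branch lhs rhs
    have hsl : ∀ j, (lhs j).Sound := fun j =>
      ih.exp _ (by simp only [Exp.rank]; have := hrk j; omega)
    have hsr : ∀ j, (rhs j).Sound := fun j =>
      ih.exp _ (by simp only [Exp.rank]; have := hrk j; omega)
    have hse : e.Sound := ih.exp _ (by simp only [Exp.rank]; omega)
    rw [Exp.Classical] at hcl
    have hbr := PureTy.sem_ctrl_branch Γl Γr hΔ he ho hl hc her hΓ hr σ ih.prog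
      (fun j => by simp only [Exp.rank]; have := hrk j; omega) hse hcl.1 hsl
    have hR := fun s : (j : Fin n) × (Γl j).Valn =>
      (hsr s.1).pinj (hcl.2.2 s.1) (hr s.1) (Valn.append (hΓ s.1) σ s.2)
    refine PInj.of_entries (fun v τ => ?_) (fun v w τ h h' => ?_) fun v τ τ' h h' => ?_
    · rcases hbr (Valn.res hΔ.left τ) with h | ⟨s, h⟩
      · exact .inl (h v τ rfl)
      · rw [h v τ rfl]; exact ((hR s).row v).val τ
    · rcases hbr (Valn.res hΔ.left τ) with h0 | ⟨s, hs⟩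
      · exact absurd (h0 v τ rfl) h
      · rw [hs _ τ rfl] at h h'
        exact ((hR s).col τ).uniq _ _ h h'
    · rcases hbr (Valn.res hΔ.left τ) with h0 | ⟨s, hs⟩
      · exact absurd (h0 v τ rfl) h
      rcases hbr (Valn.res hΔ.left τ') with h0 | ⟨s', hs'⟩
      · exact absurd (h0 v τ' rfl) h'
      have h2 := h'
      rw [hs _ τ rfl] at h
      rw [hs' _ τ' rfl] at h'
      -- By erasure both basis vectors have the same consumed part, hence the same branch, and the
      -- row of that branch is one-hot.
      have heq := PureTy.res_eq_of_erases hsr (fun j => .inl (hcl.2.2 j)) her hΔ.left _ _ h h'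
      rw [hs _ τ' heq.symm] at h2
      exact ((hR s).row v).uniq _ _ h h2

theorem PureTy.iso_of_below {e : Exp} (ih : SoundBelow e.rank) (hi : Nonempty (IsoExp e))
    {Γ Δ : Ctx} {T : Ty} (h : PureTy Γ Δ e T) (σ : Γ.Valn) : (h.sem σ)ᴴ * h.sem σ = 1 := by
  obtain ⟨hi⟩ := hi
  cases h with
  | unit =>
    ext τ τ'
    obtain rfl := Ctx.valn_empty_ext τ τ'
    rw [Matrix.mul_apply, sum_unitVal]
    simp only [Matrix.conjTranspose_apply]
    simp [PureTy.sem]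
  | cvar _ x _ hx =>
    ext τ τ'
    obtain rfl := Ctx.valn_empty_ext τ τ'
    rw [Matrix.mul_apply]
    simp only [Matrix.conjTranspose_apply]
    simp [PureTy.sem]
  | qvar _ x _ hx =>
    ext τ τ'
    have hiff : τ ⟨(x, T), Ctx.mem_single x T⟩ = τ' ⟨(x, T), Ctx.mem_single x T⟩ ↔ τ = τ' :=
      ⟨Ctx.valn_single_ext, fun h => h ▸ rfl⟩
    rw [Matrix.mul_apply]
    simp only [Matrix.conjTranspose_apply]
    simp [PureTy.sem, Matrix.one_apply, ← hiff, eq_comm]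
  | pair hΔ h₀ h₁ =>
    cases hi with
    | pair i₀ i₁ =>
    ext τ τ'
    rw [PureTy.conjTranspose_mul_pair,
      (ih.exp _ (by simp only [Exp.rank]; omega)).iso ⟨i₀⟩ h₀ σ,
      (ih.exp _ (by simp only [Exp.rank]; omega)).iso ⟨i₁⟩ h₁ σ]
    simp only [Matrix.one_apply]
    exact Valn.ite_res_mul hΔ.eq hΔ.left hΔ.right τ τ'
  | app hf he =>
    cases hi with
    | app i₀ i₁ =>
    rw [PureTy.sem_app, Matrix.conjTranspose_mul, Matrix.mul_assoc, ← Matrix.mul_assoc (hf.semᴴ),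
      (ih.prog _ (by simp only [Exp.rank]; omega)).iso ⟨i₀⟩ hf, Matrix.one_mul,
      (ih.exp _ (by simp only [Exp.rank]; omega)).iso ⟨i₁⟩ he σ]
  | @ctrl _ _ _ _ e T _ n lhs rhs Γl Γr hΔ he ho hl hc her hΓ hr =>
    cases hi with
    | ctrl hce hie hsp hir =>
    have hrk := Exp.rank_branch lhs rhs
    have hsl : ∀ j, (lhs j).Sound := fun j =>
      ih.exp _ (by simp only [Exp.rank]; have := hrk j; omega)
    have hsr : ∀ j, (rhs j).Sound := fun j =>
      ih.exp _ (by simp only [Exp.rank]; have := hrk j; omega)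
    have hse : e.Sound := ih.exp _ (by simp only [Exp.rank]; omega)
    have hbr := PureTy.sem_ctrl_branch_of_iso Γl Γr hΔ he ho hl hc her hΓ hr σ ih.prog
      (fun j => by simp only [Exp.rank]; have := hrk j; omega) hse hce hsl ⟨hie⟩ hsp
    choose s hs using hbr
    ext τ τ'
    -- With equal consumed parts the inner product is one inside a single isometric branch; with
    -- different ones the two columns have disjoint supports by erasure.
    by_cases heq : Valn.res hΔ.left τ' = Valn.res hΔ.left τ
    · have hR := (hsr (s (Valn.res hΔ.left τ)).1).iso ⟨hir _⟩ (hr _)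
        (Valn.append (hΓ _) σ (s (Valn.res hΔ.left τ)).2)
      rw [← hR, Matrix.mul_apply, Matrix.mul_apply]
      refine Finset.sum_congr rfl fun v _ => ?_
      rw [Matrix.conjTranspose_apply, Matrix.conjTranspose_apply, hs _ v τ rfl, hs _ v τ' heq]
    · have hne : τ ≠ τ' := fun h => heq (h ▸ rfl)
      rw [Matrix.one_apply_ne hne, Matrix.mul_apply]
      refine Finset.sum_eq_zero fun v _ => ?_
      by_contra h0
      have h1 : (PureTy.ctrl Γl Γr hΔ he ho hl hc her hΓ hr).sem σ v τ ≠ 0 :=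
        star_ne_zero.mp (left_ne_zero_of_mul h0)
      have h2 := right_ne_zero_of_mul h0
      rw [hs _ v τ rfl] at h1
      rw [hs _ v τ' rfl] at h2
      exact heq (PureTy.res_eq_of_erases hsr (fun j => .inr ⟨hir j⟩) her hΔ.left _ _ h2 h1)

/-! ## Mixed expressions -/

theorem diagonal_single {ι : Type} [DecidableEq ι] (i : ι) :
    Matrix.diagonal (Pi.single i 1 : ι → ℂ) = ketbra i i := by
  ext a b
  by_cases hab : a = b
  · subst hab; simp [ketbra, Matrix.single_apply, Pi.single_apply, eq_comm]
  · rw [Matrix.diagonal_apply_ne _ hab, ketbra, Matrix.single_apply, if_neg]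
    rintro ⟨rfl, rfl⟩; exact hab rfl

theorem pairAmp_oneHot {a₀ a₁ : (T : Ty) → T.Val → ℂ} {T₀ T₁ : Ty} (h₀ : OneHot (a₀ T₀))
    (h₁ : OneHot (a₁ T₁)) : OneHot (pairAmp a₀ a₁ (T₀.prod T₁)) where
  val := by
    rintro ⟨⟩
    rename_i v₀ v₁
    rcases h₀.val v₀ with h | h <;> rcases h₁.val v₁ with h' | h' <;> simp [pairAmp, h, h']
  uniq := by
    rintro ⟨⟩ ⟨⟩ h h'
    simp only [pairAmp] at h h'
    rw [h₀.uniq _ _ (left_ne_zero_of_mul h) (left_ne_zero_of_mul h'),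
      h₁.uniq _ _ (right_ne_zero_of_mul h) (right_ne_zero_of_mul h')]

theorem tensor_diagonal (a₀ a₁ : (T : Ty) → T.Val → ℂ) (T₀ T₁ : Ty) :
    tensor (Matrix.diagonal (a₀ T₀)) (Matrix.diagonal (a₁ T₁)) =
      Matrix.diagonal (pairAmp a₀ a₁ (T₀.prod T₁)) := by
  ext v w
  cases v with
  | pair v₀ v₁ =>
  cases w with
  | pair w₀ w₁ =>
  simp only [tensor, Matrix.diagonal_apply, pairAmp, Ty.Val.pair.injEq]
  by_cases h : v₀ = w₀ <;> by_cases h' : v₁ = w₁ <;> simp [h, h']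

/-- The recursion follows derivations because `discard` leaves the expression, and so its rank,
unchanged; proper subterms are handled by `SoundBelow`. -/
theorem MixTy.diag_of_below : ∀ {Γ Δ : Ctx} {e : Exp} {T : Ty} (h : MixTy Γ Δ e T),
    SoundBelow e.rank → e.Classical → ∀ (σ : Γ.Valn) (τ : Δ.Valn) (env : Env),
      env.Extends σ τ →
        OneHot (e.amp env T) ∧ h.sem σ (ketbra τ τ) = Matrix.diagonal (e.amp env T)
  | _, _, e, T, .mix h, ih, hcl, σ, τ, env, hE => by
    have hp := h.pinj_of_below ih hcl σ
    have ha : (fun v => h.sem σ v τ) = e.amp env T :=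
      funext fun v => h.sem_eq_amp ih (.inl hcl) σ τ env hE v
    rw [MixTy.sem, linExt_ketbra, hp.mul_ketbra_mul, ha]
    exact ⟨ha ▸ hp.col τ, rfl⟩
  | _, _, _, _, .discard hΔ h, ih, hcl, σ, τ, env, hE => by
    obtain ⟨h1, h2⟩ := h.diag_of_below ih hcl σ _ env (hE.res hΔ.left)
    refine ⟨h1, ?_⟩
    rw [MixTy.sem, linExt_ketbra, trace_ketbra, if_pos rfl, one_smul, h2]
  | _, _, _, _, .pair hΔ h₀ h₁, ih, hcl, σ, τ, env, hE => by
    rw [Exp.Classical] at hcl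
    obtain ⟨o₀, d₀⟩ := (ih.exp _ (by simp only [Exp.rank]; omega)).diag hcl.1 h₀ σ _ env
      (hE.res hΔ.left)
    obtain ⟨o₁, d₁⟩ := (ih.exp _ (by simp only [Exp.rank]; omega)).diag hcl.2 h₁ σ _ env
      (hE.res hΔ.right)
    have ha : ∀ e₀ e₁ : Exp, ∀ T, (Exp.pair e₀ e₁).amp env T = pairAmp (e₀.amp env) (e₁.amp env) T :=
      fun _ _ _ => funext fun _ => by rw [Exp.amp]
    rw [ha, MixTy.sem, linExt_ketbra, d₀, d₁, tensor_diagonal]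
    exact ⟨pairAmp_oneHot o₀ o₁, rfl⟩
  | _, _, .trycatch e₀ e₁, T, .trycatch hΔ h₀ h₁, ih, hcl, σ, τ, env, hE => by
    rw [Exp.Classical] at hcl
    obtain ⟨o₀, d₀⟩ := (ih.exp _ (by simp only [Exp.rank]; omega)).diag hcl.1 h₀ σ _ env
      (hE.res hΔ.left)
    obtain ⟨o₁, d₁⟩ := (ih.exp _ (by simp only [Exp.rank]; omega)).diag hcl.2 h₁ σ _ env
      (hE.res hΔ.right)
    have ha : (Exp.trycatch e₀ e₁).amp env T =
        e₀.amp env T + (1 - ∑ w, e₀.amp env T w) • e₁.amp env T :=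
      funext fun _ => by rw [Exp.amp]; rfl
    rw [MixTy.sem, linExt_ketbra, d₀, d₁, trace_ketbra, if_pos rfl, trace_ketbra, if_pos rfl,
      one_smul, Matrix.trace_diagonal, ha]
    constructor
    -- Either `e₀` gives zero and `e₁` gets weight one, or `e₀` gives a basis value and `e₁` gets
    -- weight zero.
    · rcases o₀.eq_zero_or_single with h | ⟨v, h⟩
      · simpa [h] using o₁
      · simpa [h] using OneHot.single v
    · rw [← Matrix.diagonal_smul, Matrix.diagonal_add]
      rfl
  | _, _, .app f e, T', .app (T := T) hf he, ih, hcl, σ, τ, env, hE => by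
    rw [Exp.Classical] at hcl
    obtain ⟨o, d⟩ := (ih.exp _ (by simp only [Exp.rank]; omega)).diag hcl.2 he σ τ env hE
    have ha : (Exp.app f e).amp env T' = fun v' => ∑ v : T.Val, e.amp env T v * f.amp T T' v v' := by
      funext v'
      simp only [Exp.amp_app hf.src_eq, mul_comm]
    rw [ha, MixTy.sem, LinearMap.comp_apply, d]
    rcases o.eq_zero_or_single with h | ⟨v, h⟩
    · simp only [h, Pi.zero_apply, zero_mul, Finset.sum_const_zero]
      refine ⟨OneHot.zero, ?_⟩
      have h0 : Matrix.diagonal (0 : T.Val → ℂ) = 0 := Matrix.diagonal_zero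
      rw [h0, map_zero]
      exact Matrix.diagonal_zero.symm
    · simp only [h, sum_single_mul, diagonal_single]
      exact (ih.prog _ (by simp only [Exp.rank]; omega)).diag hcl.1 hf v
  | _, _, .mtch e T n lhs rhs _, T', .mtch Γl Γr hΔ he ho hl hc hΓ hr, ih, hcl, σ, τ, env, hE => by
    rw [Exp.Classical] at hcl
    have hrk := Exp.rank_branch lhs rhs
    have hsl : ∀ j, (lhs j).Sound := fun j =>
      ih.exp _ (by simp only [Exp.rank]; have := hrk j; omega)
    have hsr : ∀ j, (rhs j).Sound := fun j =>
      ih.exp _ (by simp only [Exp.rank]; have := hrk j; omega)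
    obtain ⟨o, d⟩ := (ih.exp e (by simp only [Exp.rank]; omega)).diag hcl.1 he σ _ env
      (hE.res hΔ.left)
    have hd := fun s : (j : Fin n) × (Γl j).Valn =>
      (hsr s.1).diag (hcl.2.2 s.1) (hr s.1) _ _ _ ((hE.res hΔ.right).append (hΓ s.1) s.2)
    have ha : (Exp.mtch e T n lhs rhs T').amp env T' = fun v' => ∑ v : T.Val, e.amp env T v *
        ∑ s : (j : Fin n) × (Γl j).Valn, star ((hl s.1).sem Valn.empty v s.2) *
          (rhs s.1).amp (s.2.env.override env) T' v' := by
      funext v'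
      rw [Exp.amp]
      refine Finset.sum_congr rfl fun v _ => ?_
      rw [sum_branch_amp hl hsl hc v fun j env' => (rhs j).amp (env'.override env) T' v']
    rw [ha, MixTy.sem_mtch, linExt_ketbra, d]
    constructor
    · exact o.comb fun v => (branch_oneHot hl hsl hc ih.prog ho
        (fun j => by simp only [Exp.rank]; have := hrk j; omega) v).comb fun s => (hd s).1
    · simp only [fun s => (hd s).2, Matrix.diagonal_apply_eq]
      ext a b
      by_cases hab : a = b
      · subst hab
        simp [Matrix.sum_apply, Matrix.smul_apply]
      · simp [Matrix.sum_apply, Matrix.smul_apply, Matrix.diagonal_apply_ne _ hab]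

theorem MixTy.trace_of_below : ∀ {Γ Δ : Ctx} {e : Exp} {T : Ty} (h : MixTy Γ Δ e T),
    SoundBelow e.rank → IsoExp e → ∀ (σ : Γ.Valn) (ρ : Matrix Δ.Valn Δ.Valn ℂ),
      (h.sem σ ρ).trace = ρ.trace
  | _, _, _, _, .mix h, ih, hi, σ, ρ => by
    rw [MixTy.sem]
    exact trace_linExt (trace_mul_ketbra_mul (h.iso_of_below ih ⟨hi⟩ σ)) ρ
  | _, _, _, _, .discard hΔ h, ih, hi, σ, ρ => by
    rw [MixTy.sem]
    refine trace_linExt (fun τ τ' => ?_) ρ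
    rw [Matrix.trace_smul, h.trace_of_below ih hi, trace_ketbra, trace_ketbra, smul_eq_mul,
      mul_comm, Valn.ite_res_mul hΔ.eq]
  | _, _, _, _, .pair hΔ h₀ h₁, ih, .pair i₀ i₁, σ, ρ => by
    rw [MixTy.sem]
    refine trace_linExt (fun τ τ' => ?_) ρ
    rw [trace_tensor, (ih.exp _ (by simp only [Exp.rank]; omega)).trace ⟨i₀⟩ h₀,
      (ih.exp _ (by simp only [Exp.rank]; omega)).trace ⟨i₁⟩ h₁, trace_ketbra, trace_ketbra,
      Valn.ite_res_mul hΔ.eq]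
  | _, _, _, _, .trycatch hΔ h₀ h₁, ih, .try_ _ i, σ, ρ => by
    rw [MixTy.sem]
    refine trace_linExt (fun τ τ' => ?_) ρ
    rw [Matrix.trace_add, Matrix.trace_smul, Matrix.trace_smul,
      (ih.exp _ (by simp only [Exp.rank]; omega)).trace ⟨i⟩ h₀, sub_self, zero_smul, add_zero,
      trace_ketbra, trace_ketbra, smul_eq_mul, mul_comm, Valn.ite_res_mul hΔ.eq]
  | _, _, _, _, .trycatch hΔ h₀ h₁, ih, .catch_ _ i, σ, ρ => by
    rw [MixTy.sem]
    refine trace_linExt (fun τ τ' => ?_) ρ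
    -- The trace produced by `e₀` cancels against its loss in the weight of `e₁`, whether or not
    -- `e₀` preserves traces.
    rw [Matrix.trace_add, Matrix.trace_smul, Matrix.trace_smul,
      (ih.exp _ (by simp only [Exp.rank]; omega)).trace ⟨i⟩ h₁, smul_eq_mul, smul_eq_mul,
      ← Valn.ite_res_mul hΔ.eq hΔ.left hΔ.right τ τ', trace_ketbra, trace_ketbra]
    ring
  | _, _, _, _, .app hf he, ih, .app i₀ i₁, σ, ρ => by
    rw [MixTy.sem, LinearMap.comp_apply,
      (ih.prog _ (by simp only [Exp.rank]; omega)).trace ⟨i₀⟩ hf,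
      (ih.exp _ (by simp only [Exp.rank]; omega)).trace ⟨i₁⟩ he]
  | _, _, .mtch e T n lhs rhs _, T', .mtch Γl Γr hΔ he ho hl hc hΓ hr, ih,
      .mtch hce hie hsp hir, σ, ρ => by
    have hrk := Exp.rank_branch lhs rhs
    have hsl : ∀ j, (lhs j).Sound := fun j =>
      ih.exp _ (by simp only [Exp.rank]; have := hrk j; omega)
    have hsr : ∀ j, (rhs j).Sound := fun j =>
      ih.exp _ (by simp only [Exp.rank]; have := hrk j; omega)
    have ht := (ih.exp e (by simp only [Exp.rank]; omega)).trace ⟨hie⟩ he σ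
    rw [MixTy.sem_mtch]
    refine trace_linExt (fun τ τ' => ?_) ρ
    simp only [Matrix.trace_sum, Matrix.trace_smul,
      fun s : (j : Fin n) × (Γl j).Valn => (hsr s.1).trace ⟨hir s.1⟩ (hr s.1), smul_eq_mul]
    -- Each `v` is matched exactly once, so the branch weights sum to one; what remains of the sum
    -- over `v` is the trace of the scrutinee.
    simp only [← Finset.sum_mul, ← mul_assoc, branch_sum_eq_one hl hsl hc ih.prog ho
      (fun j => by simp only [Exp.rank]; have := hrk j; omega) hsp, mul_one]
    rw [← Valn.ite_res_mul hΔ.eq hΔ.left hΔ.right τ τ', ← trace_ketbra, ← trace_ketbra, ← ht]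
    rfl

theorem Exp.sound_of_below {e : Exp} (ih : SoundBelow e.rank) : e.Sound where
  amp ht _ _ _ h := h.sem_eq_amp ih ht
  pinj hc _ _ _ h := h.pinj_of_below ih hc
  iso hi _ _ _ h := h.iso_of_below ih hi
  diag hc _ _ _ h := h.diag_of_below ih hc
  trace hi _ _ _ h := h.trace_of_below ih hi.some

/-! ## Programs -/

theorem PureTy.finsum_amp_mul {Δ : Ctx} {e e' : Exp} {T T' : Ty} (h : PureTy Ctx.empty Δ e T)
    (h' : PureTy Ctx.empty Δ e' T') (hs : e.Sound) (ht : e.Tame) (hs' : e'.Sound) (ht' : e'.Tame)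
    (v : T.Val) (v' : T'.Val) :
    ∑ᶠ env ∈ Env.on e.fv, star (e.amp env T v) * e'.amp env T' v' =
      (h'.sem Valn.empty * (h.sem Valn.empty)ᴴ) v' v := by
  rw [h.finsum_env, Matrix.mul_apply]
  refine Finset.sum_congr rfl fun τ _ => ?_
  rw [Matrix.conjTranspose_apply, hs.amp ht h _ _ _ (Env.extends_env τ),
    hs'.amp ht' h' _ _ _ (Env.extends_env τ), mul_comm]

theorem PureProgTy.sem_eq_amp {f : Prog} (ih : SoundBelow f.rank) (ht : f.Tame) {T T' : Ty}
    (h : PureProgTy f T T') (v : T.Val) (v' : T'.Val) : h.sem v' v = f.amp T T' v v' := by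
  cases h with
  | u3 => simp [PureProgTy.sem, Prog.amp]
  | left => simp [PureProgTy.sem, Prog.amp]
  | right => simp [PureProgTy.sem, Prog.amp]
  | lam h h' =>
    rw [PureProgTy.sem, Prog.amp, h.finsum_amp_mul h'
      (ih.exp _ (by simp only [Prog.rank]; omega)) ht.lam.1
      (ih.exp _ (by simp only [Prog.rank]; omega)) ht.lam.2]
  | @rphase _ e _ r r' h =>
    have hs := ih.exp e (by simp only [Prog.rank]; omega)
    rw [PureProgTy.sem, Prog.amp, dif_pos rfl]
    rw [h.finsum_amp_mul h hs ht.rphase hs ht.rphase]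
    rfl
  | @pmatch _ _ n lhs rhs Δ ho hl ho' hr =>
    have hrk := Exp.rank_branch lhs rhs
    rw [PureProgTy.sem, Prog.amp, Matrix.sum_apply]
    refine Finset.sum_congr rfl fun j _ => ?_
    rw [(hl j).finsum_amp_mul (hr j)
      (ih.exp _ (by simp only [Prog.rank]; have := hrk j; omega)) (ht.pmatch j).1
      (ih.exp _ (by simp only [Prog.rank]; have := hrk j; omega)) (ht.pmatch j).2]

theorem leftMatrix_pinj (T₀ T₁ : Ty) : PInj (leftMatrix T₀ T₁) := by
  refine PInj.of_entries ?_ ?_ ?_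
  · rintro (_ | v | v) w
    · by_cases h : v = w <;> simp [leftMatrix, h]
    · simp [leftMatrix]
  · rintro (_ | v | v) (_ | v' | v') w h h' <;> simp_all [leftMatrix]
  · rintro (_ | v | v) w w' h h' <;> simp_all [leftMatrix]

theorem rightMatrix_pinj (T₀ T₁ : Ty) : PInj (rightMatrix T₀ T₁) := by
  refine PInj.of_entries ?_ ?_ ?_
  · rintro (_ | v | v) w
    · simp [rightMatrix]
    · by_cases h : v = w <;> simp [rightMatrix, h]
  · rintro (_ | v | v) (_ | v' | v') w h h' <;> simp_all [rightMatrix]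
  · rintro (_ | v | v) w w' h h' <;> simp_all [rightMatrix]

theorem PureProgTy.pinj_of_below {f : Prog} (ih : SoundBelow f.rank) (hcl : f.Classical)
    {T T' : Ty} (h : PureProgTy f T T') : PInj h.sem := by
  cases h with
  | u3 => rw [Prog.Classical] at hcl; exact hcl.elim
  | left => rw [PureProgTy.sem]; exact leftMatrix_pinj _ _
  | right => rw [PureProgTy.sem]; exact rightMatrix_pinj _ _
  | lam h h' =>
    rw [Prog.Classical] at hcl
    rw [PureProgTy.sem]
    exact ((ih.exp _ (by simp only [Prog.rank]; omega)).pinj hcl.2 h' _).mul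
      ((ih.exp _ (by simp only [Prog.rank]; omega)).pinj hcl.1 h _).conjTranspose
  | rphase r r' h => rw [Prog.Classical] at hcl; exact hcl.elim
  | @pmatch _ _ n lhs rhs Δ ho hl ho' hr =>
    have hrk := Exp.rank_branch lhs rhs
    rw [Prog.Classical] at hcl
    rw [PureProgTy.sem]
    refine PInj.sum_mul
      (fun j => (ih.exp _ ?_).pinj (hcl.1 j) (hl j) _)
      (ho.orthogonal ih.prog (fun j => ?_) hl)
      (fun j => (ih.exp _ ?_).pinj (hcl.2 j) (hr j) _)
      (ho'.orthogonal ih.prog (fun j => ?_) hr)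
    all_goals simp only [Prog.rank]; have := hrk j; omega

/-- If `M` is an isometry, `M * Mᴴ` is a self-adjoint projector; unit phases on it and on its
complement give a unitary, so no spanning condition is needed. -/
theorem rphase_iso {ι κ : Type} [Fintype ι] [Fintype κ] [DecidableEq ι] [DecidableEq κ]
    {M : Matrix κ ι ℂ} (hM : Mᴴ * M = 1) (r r' : ℝ) :
    (Complex.exp (Complex.I * r) • (M * Mᴴ) + Complex.exp (Complex.I * r') • (1 - M * Mᴴ))ᴴ *
      (Complex.exp (Complex.I * r) • (M * Mᴴ) + Complex.exp (Complex.I * r') • (1 - M * Mᴴ)) =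
      1 := by
  have hP : (M * Mᴴ) * (M * Mᴴ) = M * Mᴴ := by
    rw [Matrix.mul_assoc, ← Matrix.mul_assoc Mᴴ, hM, Matrix.one_mul]
  have hH : (M * Mᴴ)ᴴ = M * Mᴴ := by
    rw [Matrix.conjTranspose_mul, Matrix.conjTranspose_conjTranspose]
  generalize M * Mᴴ = P at hP hH
  have h1 := star_exp_mul_exp r
  have h2 := star_exp_mul_exp r'
  rw [Matrix.conjTranspose_add, Matrix.conjTranspose_smul, Matrix.conjTranspose_smul,
    Matrix.conjTranspose_sub, Matrix.conjTranspose_one, hH]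
  simp only [add_mul, mul_add, smul_mul_assoc, mul_smul_comm, sub_mul, mul_sub, hP, one_mul,
    mul_one, sub_self, smul_zero]
  rw [mul_comm] at h1 h2
  simp only [add_zero, add_sub_cancel_left, smul_smul, h1, h2, one_smul, add_sub_cancel]

theorem PureProgTy.iso_of_below {f : Prog} (ih : SoundBelow f.rank) (hi : Nonempty (IsoProg f))
    {T T' : Ty} (h : PureProgTy f T T') : h.semᴴ * h.sem = 1 := by
  obtain ⟨hi⟩ := hi
  cases h with
  | u3 => rw [PureProgTy.sem]; exact u3Matrix_iso _ _ _
  | left => rw [PureProgTy.sem]; exact leftMatrix_iso _ _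
  | right => rw [PureProgTy.sem]; exact rightMatrix_iso _ _
  | lam h h' =>
    cases hi with
    | lam hs hi =>
    have h1 := (ih.exp _ (by simp only [Prog.rank]; omega)).iso (hs.iso _ (by simp)) h Valn.empty
    have h2 := (ih.exp _ (by simp only [Prog.rank]; omega)).iso ⟨hi⟩ h' Valn.empty
    -- The adjoint of the pattern acts first, so the pattern must be unitary and not merely
    -- isometric; this is where spanning enters.
    rw [PureProgTy.sem, Matrix.conjTranspose_mul, Matrix.conjTranspose_conjTranspose,
      Matrix.mul_assoc, ← Matrix.mul_assoc (h'.sem _)ᴴ, h2, Matrix.one_mul,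
      hs.mul_conjTranspose h h1]
  | rphase r r' h =>
    cases hi with
    | rphase _ _ _ hi =>
    rw [PureProgTy.sem]
    exact rphase_iso ((ih.exp _ (by simp only [Prog.rank]; omega)).iso ⟨hi⟩ h Valn.empty) r r'
  | @pmatch _ _ n lhs rhs Δ ho hl ho' hr =>
    cases hi with
    | pmatch hs hi =>
    have hrk := Exp.rank_branch lhs rhs
    have hlt : ∀ j, (lhs j).rank < (Prog.pmatch T n lhs rhs T').rank ∧
        (rhs j).rank < (Prog.pmatch T n lhs rhs T').rank := fun j => by
      simp only [Prog.rank]; have := hrk j; omega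
    have il := fun j => (ih.exp _ (hlt j).1).iso (hs.iso_ofFn j) (hl j) Valn.empty
    have ir := fun j => (ih.exp _ (hlt j).2).iso ⟨hi j⟩ (hr j) Valn.empty
    have ol := ho.orthogonal ih.prog (fun j => (hlt j).1.le) hl
    have or := ho'.orthogonal ih.prog (fun j => (hlt j).2.le) hr
    -- Orthogonality of the right-hand sides removes the cross terms, and the diagonal ones add up
    -- to the resolution of the identity by the left-hand sides.
    rw [PureProgTy.sem, Matrix.conjTranspose_sum, Matrix.sum_mul,
      ← hs.sum_mul_conjTranspose hl il ol]
    refine Finset.sum_congr rfl fun j _ => ?_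
    rw [Matrix.mul_sum, Finset.sum_eq_single j]
    · rw [Matrix.conjTranspose_mul, Matrix.conjTranspose_conjTranspose, Matrix.mul_assoc,
        ← Matrix.mul_assoc ((hr j).sem _)ᴴ, ir, Matrix.one_mul]
    · intro k _ hk
      rw [Matrix.conjTranspose_mul, Matrix.conjTranspose_conjTranspose, Matrix.mul_assoc,
        ← Matrix.mul_assoc ((hr j).sem _)ᴴ, or j k hk.symm, Matrix.zero_mul, Matrix.mul_zero]
    · simp

theorem MixProgTy.diag_of_below {f : Prog} (ih : SoundBelow f.rank) (hcl : f.Classical)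
    {T T' : Ty} (h : MixProgTy f T T') (v : T.Val) :
    OneHot (f.amp T T' v) ∧ h.sem (ketbra v v) = Matrix.diagonal (f.amp T T' v) := by
  cases h with
  | channel h =>
    have hp := h.pinj_of_below ih hcl
    have ha : (fun v' => h.sem v' v) = f.amp T T' v :=
      funext fun v' => h.sem_eq_amp ih (.inl hcl) v v'
    rw [MixProgTy.sem, linExt_ketbra, hp.mul_ketbra_mul, ha]
    exact ⟨ha ▸ hp.col v, rfl⟩
  | @lam Δ e e' _ _ h h' =>
    rw [Prog.Classical] at hcl
    have hs : e.Sound := ih.exp _ (by simp only [Prog.rank]; omega)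
    have hs' : e'.Sound := ih.exp _ (by simp only [Prog.rank]; omega)
    have hp := hs.pinj hcl.1 h Valn.empty
    have ha : (Prog.lam e T e').amp T T' v = fun v' =>
        ∑ τ : Δ.Valn, star (h.sem Valn.empty v τ) * e'.amp τ.env T' v' := by
      funext v'
      rw [Prog.amp, h.finsum_env]
      refine Finset.sum_congr rfl fun τ _ => ?_
      rw [hs.amp (.inl hcl.1) h _ _ _ (Env.extends_env τ)]
    have hk := hp.conjTranspose.mul_ketbra_mul v
    rw [Matrix.conjTranspose_conjTranspose] at hk
    have ho := hp.conjTranspose.col v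
    rw [ha, MixProgTy.sem, linExt_ketbra, hk]
    -- The adjoint of a classical pattern sends `v` to zero or to a single binding, and the body is
    -- then evaluated on that basis state.
    rcases ho.eq_zero_or_single with h0 | ⟨τ, h1⟩
    · have h0' : ∀ τ, star (h.sem Valn.empty v τ) = 0 := fun τ => congrFun h0 τ
      have hd : Matrix.diagonal (0 : Δ.Valn → ℂ) = 0 := Matrix.diagonal_zero
      simp only [h0', zero_mul, Finset.sum_const_zero]
      rw [h0, hd, map_zero]
      exact ⟨OneHot.zero, Matrix.diagonal_zero.symm⟩
    · have h1' : ∀ τ', star (h.sem Valn.empty v τ') = (Pi.single τ 1 : _ → ℂ) τ' :=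
        fun τ' => congrFun h1 τ'
      simp only [h1', sum_single_mul]
      rw [h1, diagonal_single]
      exact hs'.diag hcl.2 h' _ _ _ (Env.extends_env τ)

theorem MixProgTy.trace_of_below {f : Prog} (ih : SoundBelow f.rank) (hi : Nonempty (IsoProg f))
    {T T' : Ty} (h : MixProgTy f T T') (ρ : Matrix T.Val T.Val ℂ) :
    (h.sem ρ).trace = ρ.trace := by
  cases h with
  | channel h =>
    rw [MixProgTy.sem]
    exact trace_linExt (trace_mul_ketbra_mul (h.iso_of_below ih hi)) ρ
  | lam h h' =>
    obtain ⟨hi⟩ := hi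
    cases hi with
    | lam hs hi =>
    have h1 := (ih.exp _ (by simp only [Prog.rank]; omega)).iso (hs.iso _ (by simp)) h Valn.empty
    have h2 := (ih.exp _ (by simp only [Prog.rank]; omega)).trace ⟨hi⟩ h' Valn.empty
    rw [MixProgTy.sem]
    refine trace_linExt (fun v v' => ?_) ρ
    rw [h2, Matrix.trace_mul_comm, ← Matrix.mul_assoc, hs.mul_conjTranspose h h1, Matrix.one_mul,
      trace_ketbra]

theorem Prog.sound_of_below {f : Prog} (ih : SoundBelow f.rank) : f.Sound where
  amp ht _ _ h := h.sem_eq_amp ih ht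
  pinj hc _ _ h := h.pinj_of_below ih hc
  iso hi _ _ h := h.iso_of_below ih hi
  diag hc _ _ h := h.diag_of_below ih hc
  trace hi _ _ h := h.trace_of_below ih hi

-- Closing the induction on rank, and norms from matrix identities.

theorem soundBelow (N : ℕ) : SoundBelow N := by
  induction N with
  | zero => exact ⟨fun _ h => absurd h (Nat.not_lt_zero _), fun _ h => absurd h (Nat.not_lt_zero _)⟩
  | succ N ih =>
    have hle : ∀ {m : ℕ}, m < N + 1 → SoundBelow m := fun hm =>
      ⟨fun e he => ih.exp e (by omega), fun f hf => ih.prog f (by omega)⟩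
    exact ⟨fun e he => Exp.sound_of_below (hle he), fun f hf => Prog.sound_of_below (hle hf)⟩

theorem Exp.sound (e : Exp) : e.Sound := Exp.sound_of_below (soundBelow _)

theorem Prog.sound (f : Prog) : f.Sound := Prog.sound_of_below (soundBelow _)

theorem norm_toEuclideanLin_of_iso {ι κ : Type} [Fintype ι] [DecidableEq ι] [Fintype κ]
    [DecidableEq κ] {M : Matrix κ ι ℂ} (hM : Mᴴ * M = 1) (ψ : EuclideanSpace ℂ ι) :
    ‖Matrix.toEuclideanLin M ψ‖ = ‖ψ‖ := by
  have h : inner ℂ (Matrix.toEuclideanLin M ψ) (Matrix.toEuclideanLin M ψ) = inner ℂ ψ ψ := by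
    rw [← LinearMap.adjoint_inner_left, ← Matrix.toEuclideanLin_conjTranspose_eq_adjoint]
    congr 1
    have := congrArg (fun A => Matrix.toEuclideanLin A ψ) hM
    simpa [Matrix.toLpLin_apply, Matrix.mulVec_mulVec] using this
  rw [inner_self_eq_norm_sq_to_K, inner_self_eq_norm_sq_to_K] at h
  have h2 : ‖Matrix.toEuclideanLin M ψ‖ ^ 2 = ‖ψ‖ ^ 2 := by exact_mod_cast h
  exact (sq_eq_sq₀ (norm_nonneg _) (norm_nonneg _)).mp h2

end Qunity

end

theorem mainTheorem2 :
    (∀ (Γ Δ : Qunity.Ctx) (e : Qunity.Exp) (T : Qunity.Ty)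
      (h : Qunity.PureTy Γ Δ e T) (_ : Qunity.IsoExp e) (σ : Γ.Valn) (ψ : Δ.H),
      ‖Matrix.toEuclideanLin (h.sem σ) ψ‖ = ‖ψ‖) ∧
    (∀ (Γ Δ : Qunity.Ctx) (e : Qunity.Exp) (T : Qunity.Ty)
      (h : Qunity.MixTy Γ Δ e T) (_ : Qunity.IsoExp e) (σ : Γ.Valn)
      (ρ : Matrix Δ.Valn Δ.Valn ℂ),
      (h.sem σ ρ).trace = ρ.trace) ∧
    (∀ (f : Qunity.Prog) (T T' : Qunity.Ty)
      (h : Qunity.PureProgTy f T T') (_ : Qunity.IsoProg f) (ψ : T.H),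
      ‖Matrix.toEuclideanLin h.sem ψ‖ = ‖ψ‖) ∧
    (∀ (f : Qunity.Prog) (T T' : Qunity.Ty)
      (h : Qunity.MixProgTy f T T') (_ : Qunity.IsoProg f)
      (ρ : Matrix T.Val T.Val ℂ),
      (h.sem ρ).trace = ρ.trace) :=
  ⟨fun _ _ e _ h hi σ ψ => Qunity.norm_toEuclideanLin_of_iso (e.sound.iso ⟨hi⟩ h σ) ψ,
    fun _ _ e _ h hi σ ρ => e.sound.trace ⟨hi⟩ h σ ρ,
    fun f _ _ h hi ψ => Qunity.norm_toEuclideanLin_of_iso (f.sound.iso ⟨hi⟩ h) ψ,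
    fun f _ _ h hi ρ => f.sound.trace ⟨hi⟩ h ρ⟩
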